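/- Let $X_0,X_1$ be Banach spaces (over $\mathbb K=\mathbb R$ or $\mathbb C$) continuously embedded in a common Hausdorff topological vector space, i.e. let $\vec X=(X_0,X_1)$ be a Banach couple, and let $\vec Y=(Y_0,Y_1)$ be another Banach couple over $\mathbb K$. Let $T\colon (X_0,X_1)\to(Y_0,Y_1)$ be a bounded linear operator, that is, a linear map $T\colon X_0+X_1\to Y_0+Y_1$ whose restrictions $T|_{X_j}$ are bounded operators $X_j\to Y_j$ for $j=0,1$. For a Banach couple $\vec A=(A_0,A_1)$, $x\in A_0+A_1$ and $t>0$ put $$K(t,x;\vec A)=\inf\{\|a_0\|_{A_0}+t\,\|a_1\|_{A_1} : a_0\in A_0,\ a_1\in A_1,\ x=a_0+a_1\},$$ and for $\theta\in(0,1)$, $1\le q\le\infty$ let $(A_0,A_1)_{\theta,q}$ be the space of all $x\in A_0+A_1$ with $$\|x\|_{\theta,q}=\Big(\int_0^\infty\big(t^{-\theta}K(t,x;\vec A)\big)^q\,\frac{dt}{t}\Big)^{1/q}<\infty\quad\Big(\|x\|_{\theta,\infty}=\sup_{t>0}t^{-\theta}K(t,x;\vec A)<\infty\ \text{ if } q=\infty\Big).$$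 Let $T_\theta\colon (X_0,X_1)_{\theta,q}\to(Y_0,Y_1)_{\theta,q}$ denote the restriction of $T$. **Theorem.** Fix $1\le q\le\infty$ and let $I\subset(0,1)$ be an interval of invertibility of $T$ for the real method $(\cdot)_{\theta,q}$, that is, an interval such that $T_\theta$ is invertible (an isomorphism with bounded inverse) for every $\theta\in I$; for instance, a connected component of $\{\theta\in(0,1): T_\theta \text{ is invertible}\}$. Then for all $\theta_0,\theta_1\in I$ the inverses $T_{\theta_0}^{-1}$ and $T_{\theta_1}^{-1}$ agree on $(Y_0,Y_1)_{\theta_0,q}\cap(Y_0,Y_1)_{\theta_1,q}$: one has $T_{\theta_0}^{-1}y=T_{\theta_1}^{-1}y$ in $X_0+X_1$ for every $y$ in this intersection. -/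

import Mathlib

open Set MeasureTheory
open scoped ENNReal Topology

noncomputable section

/-- A Banach couple `(A₀, A₁)`: two Banach spaces, each continuously and injectively embedded in a
common Hausdorff topological vector space `E`. -/
structure BanachCouple (𝕜 A₀ A₁ E : Type*) [RCLike 𝕜]
    [NormedAddCommGroup A₀] [NormedSpace 𝕜 A₀] [CompleteSpace A₀]
    [NormedAddCommGroup A₁] [NormedSpace 𝕜 A₁] [CompleteSpace A₁]
    [AddCommGroup E] [Module 𝕜 E] [TopologicalSpace E] [IsTopologicalAddGroup E]
    [ContinuousSMul 𝕜 E] [T2Space E] where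
  ι₀ : A₀ →L[𝕜] E
  ι₁ : A₁ →L[𝕜] E
  injective₀ : Function.Injective ι₀
  injective₁ : Function.Injective ι₁

/-- The norm of `t ↦ t ^ (-θ) * g t` in `L^q((0, ∞), dt / t)`; for `q = ∞` it is the supremum over
`t > 0`. -/
def weightedNorm (θ : ℝ) (q : ℝ≥0∞) (g : ℝ → ℝ≥0∞) : ℝ≥0∞ :=
  if q = ∞ then ⨆ (t : ℝ) (_ : 0 < t), ENNReal.ofReal (t ^ (-θ)) * g t
  else (∫⁻ t in Ioi (0 : ℝ),
    (ENNReal.ofReal (t ^ (-θ)) * g t) ^ q.toReal / ENNReal.ofReal t) ^ (1 / q.toReal)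

theorem weightedNorm_mono (θ : ℝ) (q : ℝ≥0∞) {g h : ℝ → ℝ≥0∞} (H : ∀ t, 0 < t → g t ≤ h t) :
    weightedNorm θ q g ≤ weightedNorm θ q h := by
  unfold weightedNorm
  split_ifs with hq
  · gcongr with t ht
    exact H t ht
  · refine ENNReal.rpow_le_rpow ?_ (by positivity)
    refine setLIntegral_mono' measurableSet_Ioi fun t ht => ?_
    have := H t ht
    gcongr

theorem measurable_weight (θ : ℝ) : Measurable fun t : ℝ => ENNReal.ofReal (t ^ (-θ)) := by
  fun_prop

theorem weightedNorm_const_mul (θ : ℝ) {q : ℝ≥0∞} (hq : 1 ≤ q) (c : ℝ≥0∞) (hc : c ≠ ∞)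
    {g : ℝ → ℝ≥0∞} :
    weightedNorm θ q (fun t => c * g t) = c * weightedNorm θ q g := by
  unfold weightedNorm
  split_ifs with h
  · simp only [ENNReal.mul_iSup]
    refine iSup_congr fun t => iSup_congr fun _ => ?_
    ring
  · have hq0 : 0 < q.toReal := ENNReal.toReal_pos (by positivity) h
    have : ∀ t : ℝ, (ENNReal.ofReal (t ^ (-θ)) * (c * g t)) ^ q.toReal / ENNReal.ofReal t
        = c ^ q.toReal * ((ENNReal.ofReal (t ^ (-θ)) * g t) ^ q.toReal / ENNReal.ofReal t) := by
      intro t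
      rw [mul_left_comm, ENNReal.mul_rpow_of_nonneg _ _ hq0.le, mul_div_assoc]
    simp only [this]
    rw [lintegral_const_mul' _ _ (ENNReal.rpow_ne_top_of_nonneg hq0.le hc),
      ENNReal.mul_rpow_of_nonneg _ _ (by positivity), ← ENNReal.rpow_mul,
      mul_one_div_cancel hq0.ne', ENNReal.rpow_one]

theorem weightedNorm_add_le (θ : ℝ) {q : ℝ≥0∞} (hq : 1 ≤ q) {g h : ℝ → ℝ≥0∞}
    (hg : Measurable g) (hh : Measurable h) :
    weightedNorm θ q (fun t => g t + h t) ≤ weightedNorm θ q g + weightedNorm θ q h := by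
  unfold weightedNorm
  split_ifs with hq'
  · refine iSup₂_le fun t ht => ?_
    rw [mul_add]
    exact add_le_add
      (le_iSup₂ (f := fun (t : ℝ) (_ : 0 < t) => ENNReal.ofReal (t ^ (-θ)) * g t) t ht)
      (le_iSup₂ (f := fun (t : ℝ) (_ : 0 < t) => ENNReal.ofReal (t ^ (-θ)) * h t) t ht)
  · have h1 : 1 ≤ q.toReal := by
      rw [← ENNReal.toReal_one]
      exact ENNReal.toReal_mono hq' hq
    have hq0 : 0 < q.toReal := by linarith
    have key : ∀ k : ℝ → ℝ≥0∞, ∀ t : ℝ,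
        (ENNReal.ofReal (t ^ (-θ)) * k t) ^ q.toReal / ENNReal.ofReal t
        = ((ENNReal.ofReal (t ^ (-θ)) * k t) * (ENNReal.ofReal t)⁻¹ ^ (1 / q.toReal))
            ^ q.toReal := by
      intro k t
      rw [ENNReal.mul_rpow_of_nonneg (ENNReal.ofReal (t ^ (-θ)) * k t) _ hq0.le,
        ← ENNReal.rpow_mul (ENNReal.ofReal t)⁻¹, one_div_mul_cancel hq0.ne', ENNReal.rpow_one,
        div_eq_mul_inv]
    rw [lintegral_congr (key g), lintegral_congr (key h),
      lintegral_congr (key fun t => g t + h t)]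
    have hm : ∀ k : ℝ → ℝ≥0∞, Measurable k → Measurable fun t : ℝ =>
        (ENNReal.ofReal (t ^ (-θ)) * k t) * (ENNReal.ofReal t)⁻¹ ^ (1 / q.toReal) := by
      intro k hk
      have := measurable_weight θ
      fun_prop
    refine le_trans (le_of_eq ?_)
      (ENNReal.lintegral_Lp_add_le (hm g hg).aemeasurable (hm h hh).aemeasurable h1)
    congr 1
    refine lintegral_congr fun t => ?_
    simp only [Pi.add_apply]
    congr 1
    ring

theorem exists_eq_zero_of_weightedNorm_eq_zero (θ : ℝ) {q : ℝ≥0∞} (hq : 1 ≤ q) {g : ℝ → ℝ≥0∞}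
    (hg : Measurable g) (h0 : weightedNorm θ q g = 0) : ∃ t : ℝ, 0 < t ∧ g t = 0 := by
  have hw : ∀ t : ℝ, 0 < t → ENNReal.ofReal (t ^ (-θ)) ≠ 0 := fun t ht => by
    simpa using Real.rpow_pos_of_pos ht _
  unfold weightedNorm at h0
  split_ifs at h0 with hq'
  · have h1 : ENNReal.ofReal ((1 : ℝ) ^ (-θ)) * g 1 ≤ 0 := by
      rw [← h0]
      exact le_iSup₂ (f := fun (t : ℝ) (_ : 0 < t) => ENNReal.ofReal (t ^ (-θ)) * g t) 1 one_pos
    refine ⟨1, one_pos, ?_⟩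
    have h2 := nonpos_iff_eq_zero.mp h1
    exact (mul_eq_zero.mp h2).resolve_left (hw 1 one_pos)
  · have hq0 : 0 < q.toReal := ENNReal.toReal_pos (by positivity) hq'
    have h1 := (ENNReal.rpow_eq_zero_iff_of_pos (by positivity)).mp h0
    have hmeas : Measurable fun t : ℝ =>
        (ENNReal.ofReal (t ^ (-θ)) * g t) ^ q.toReal / ENNReal.ofReal t := by
      have := measurable_weight θ
      fun_prop
    rw [setLIntegral_eq_zero_iff measurableSet_Ioi hmeas] at h1
    by_contra! hne
    have h2 : volume (Ioi (0 : ℝ)) = 0 := by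
      refine measure_mono_null (fun t ht => ?_) (ae_iff.mp h1)
      simp only [mem_ofPred_eq, Classical.not_imp]
      refine ⟨ht, ENNReal.div_ne_zero.mpr ⟨?_, ENNReal.ofReal_ne_top⟩⟩
      rw [Ne, ENNReal.rpow_eq_zero_iff_of_pos hq0]
      exact mul_ne_zero (hw t ht) (hne t ht)
    simp at h2

namespace BanachCouple

section

variable {𝕜 A₀ A₁ E : Type*} [RCLike 𝕜]
  [NormedAddCommGroup A₀] [NormedSpace 𝕜 A₀] [CompleteSpace A₀]
  [NormedAddCommGroup A₁] [NormedSpace 𝕜 A₁] [CompleteSpace A₁]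
  [AddCommGroup E] [Module 𝕜 E] [TopologicalSpace E] [IsTopologicalAddGroup E]
  [ContinuousSMul 𝕜 E] [T2Space E]

/-- The algebraic sum `A₀ + A₁` inside the ambient space. -/
def sum (A : BanachCouple 𝕜 A₀ A₁ E) : Submodule 𝕜 E :=
  LinearMap.range A.ι₀.toLinearMap ⊔ LinearMap.range A.ι₁.toLinearMap

/-- The inclusion of `A₀` in `A₀ + A₁`. -/
def incl₀ (A : BanachCouple 𝕜 A₀ A₁ E) : A₀ →ₗ[𝕜] A.sum :=
  A.ι₀.toLinearMap.codRestrict A.sum fun a =>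
    (le_sup_left : LinearMap.range A.ι₀.toLinearMap ≤ A.sum) (LinearMap.mem_range_self _ a)

/-- The inclusion of `A₁` in `A₀ + A₁`. -/
def incl₁ (A : BanachCouple 𝕜 A₀ A₁ E) : A₁ →ₗ[𝕜] A.sum :=
  A.ι₁.toLinearMap.codRestrict A.sum fun a =>
    (le_sup_right : LinearMap.range A.ι₁.toLinearMap ≤ A.sum) (LinearMap.mem_range_self _ a)

/-- Peetre's functional `K(t, x) = inf {‖a₀‖ + t ‖a₁‖ : x = a₀ + a₁}`. -/
def peetreK (A : BanachCouple 𝕜 A₀ A₁ E) (t : ℝ) (x : A.sum) : ℝ≥0∞ :=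
  ⨅ (a : A₀ × A₁) (_ : A.incl₀ a.1 + A.incl₁ a.2 = x), (‖a.1‖ₑ + ENNReal.ofReal t * ‖a.2‖ₑ)

/-- The norm of the real interpolation space `(A₀, A₁)_{θ,q}` (possibly infinite). -/
def realENorm (A : BanachCouple 𝕜 A₀ A₁ E) (θ : ℝ) (q : ℝ≥0∞) (x : A.sum) : ℝ≥0∞ :=
  weightedNorm θ q fun t => A.peetreK t x

theorem measurable_peetreK (A : BanachCouple 𝕜 A₀ A₁ E) (x : A.sum) :
    Measurable fun t => A.peetreK t x := by
  refine Monotone.measurable fun s t hst => ?_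
  unfold peetreK
  gcongr

theorem peetreK_le (A : BanachCouple 𝕜 A₀ A₁ E) (t : ℝ) {x : A.sum} {a₀ : A₀} {a₁ : A₁}
    (h : A.incl₀ a₀ + A.incl₁ a₁ = x) : A.peetreK t x ≤ ‖a₀‖ₑ + ENNReal.ofReal t * ‖a₁‖ₑ :=
  iInf₂_le (f := fun (a : A₀ × A₁) (_ : A.incl₀ a.1 + A.incl₁ a.2 = x) =>
    ‖a.1‖ₑ + ENNReal.ofReal t * ‖a.2‖ₑ) (a₀, a₁) h

theorem peetreK_add_le (A : BanachCouple 𝕜 A₀ A₁ E) (t : ℝ) (x y : A.sum) :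
    A.peetreK t (x + y) ≤ A.peetreK t x + A.peetreK t y := by
  conv_rhs => unfold peetreK
  simp only [ENNReal.iInf_add, ENNReal.add_iInf]
  refine le_iInf fun a => le_iInf fun ha => le_iInf fun b => le_iInf fun hb => ?_
  have h : A.incl₀ (a.1 + b.1) + A.incl₁ (a.2 + b.2) = x + y := by
    rw [map_add, map_add, ← ha, ← hb]
    abel
  calc A.peetreK t (x + y) ≤ ‖a.1 + b.1‖ₑ + ENNReal.ofReal t * ‖a.2 + b.2‖ₑ := A.peetreK_le t h
    _ ≤ (‖a.1‖ₑ + ‖b.1‖ₑ) + ENNReal.ofReal t * (‖a.2‖ₑ + ‖b.2‖ₑ) := by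
        gcongr <;> exact enorm_add_le _ _
    _ = _ := by ring

theorem peetreK_zero (A : BanachCouple 𝕜 A₀ A₁ E) (t : ℝ) : A.peetreK t 0 = 0 := by
  refine le_antisymm ?_ bot_le
  simpa using A.peetreK_le t (x := 0) (a₀ := 0) (a₁ := 0) (by simp)

theorem peetreK_smul_le (A : BanachCouple 𝕜 A₀ A₁ E) (t : ℝ) (c : 𝕜) (x : A.sum) :
    A.peetreK t (c • x) ≤ ‖c‖ₑ * A.peetreK t x := by
  by_cases hc : c = 0
  · subst hc
    simp [peetreK_zero]
  · have hc0 : ‖c‖ₑ ≠ 0 := by simpa using hc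
    conv_rhs => unfold peetreK
    simp only [ENNReal.mul_iInf_of_ne hc0 enorm_ne_top]
    refine le_iInf₂ fun a ha => ?_
    have h : A.incl₀ (c • a.1) + A.incl₁ (c • a.2) = c • x := by
      rw [map_smul, map_smul, ← smul_add, ha]
    refine (A.peetreK_le t h).trans (le_of_eq ?_)
    rw [enorm_smul, enorm_smul]
    ring

theorem eq_zero_of_peetreK_eq_zero (A : BanachCouple 𝕜 A₀ A₁ E) {t : ℝ} (ht : 0 < t) {x : A.sum}
    (h : A.peetreK t x = 0) : x = 0 := by
  have hex : ∀ n : ℕ, ∃ a : A₀ × A₁, A.incl₀ a.1 + A.incl₁ a.2 = x ∧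
      ‖a.1‖ₑ + ENNReal.ofReal t * ‖a.2‖ₑ < (n : ℝ≥0∞)⁻¹ := by
    intro n
    have hlt : A.peetreK t x < (n : ℝ≥0∞)⁻¹ := by
      rw [h]
      simp
    unfold peetreK at hlt
    obtain ⟨a, ha⟩ := iInf_lt_iff.mp hlt
    obtain ⟨ha', hlt'⟩ := iInf_lt_iff.mp ha
    exact ⟨a, ha', hlt'⟩
  choose a ha hlt using hex
  have hlim : Filter.Tendsto (fun n : ℕ => ‖(a n).1‖ₑ + ENNReal.ofReal t * ‖(a n).2‖ₑ)
      Filter.atTop (𝓝 0) :=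
    tendsto_of_tendsto_of_tendsto_of_le_of_le tendsto_const_nhds
      ENNReal.tendsto_inv_nat_nhds_zero (fun _ => bot_le) fun n => (hlt n).le
  have h1 : Filter.Tendsto (fun n => (a n).1) Filter.atTop (𝓝 0) := by
    rw [tendsto_zero_iff_enorm_tendsto_zero]
    exact tendsto_of_tendsto_of_tendsto_of_le_of_le tendsto_const_nhds hlim (fun _ => bot_le)
      fun n => le_self_add
  have h2 : Filter.Tendsto (fun n => (a n).2) Filter.atTop (𝓝 0) := by
    rw [tendsto_zero_iff_enorm_tendsto_zero]
    have ht0 : ENNReal.ofReal t ≠ 0 := by simpa using ht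
    have h3 := ENNReal.Tendsto.const_mul (a := (ENNReal.ofReal t)⁻¹) hlim
      (Or.inr (ENNReal.inv_ne_top.mpr ht0))
    rw [mul_zero] at h3
    refine tendsto_of_tendsto_of_tendsto_of_le_of_le tendsto_const_nhds h3 (fun _ => bot_le)
      fun n => ?_
    calc ‖(a n).2‖ₑ = (ENNReal.ofReal t)⁻¹ * (ENNReal.ofReal t * ‖(a n).2‖ₑ) := by
          rw [← mul_assoc, ENNReal.inv_mul_cancel ht0 ENNReal.ofReal_ne_top, one_mul]
      _ ≤ _ := by
          gcongr
          exact le_add_self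
  have h4 : Filter.Tendsto (fun n => A.ι₀ (a n).1 + A.ι₁ (a n).2) Filter.atTop (𝓝 0) := by
    have := ((A.ι₀.continuous.tendsto 0).comp h1).add ((A.ι₁.continuous.tendsto 0).comp h2)
    simpa using this
  have h5 : ∀ n, A.ι₀ (a n).1 + A.ι₁ (a n).2 = (x : E) := fun n => congrArg Subtype.val (ha n)
  simp only [h5] at h4
  exact Subtype.ext (tendsto_nhds_unique tendsto_const_nhds h4)

theorem realENorm_add_le (A : BanachCouple 𝕜 A₀ A₁ E) (θ : ℝ) {q : ℝ≥0∞} (hq : 1 ≤ q)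
    (x y : A.sum) : A.realENorm θ q (x + y) ≤ A.realENorm θ q x + A.realENorm θ q y :=
  (weightedNorm_mono θ q fun t _ => A.peetreK_add_le t x y).trans
    (weightedNorm_add_le θ hq (A.measurable_peetreK x) (A.measurable_peetreK y))

theorem realENorm_smul_le (A : BanachCouple 𝕜 A₀ A₁ E) (θ : ℝ) {q : ℝ≥0∞} (hq : 1 ≤ q)
    (c : 𝕜) (x : A.sum) : A.realENorm θ q (c • x) ≤ ‖c‖ₑ * A.realENorm θ q x :=
  (weightedNorm_mono θ q fun t _ => A.peetreK_smul_le t c x).trans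
    (weightedNorm_const_mul θ hq _ enorm_ne_top).le

theorem realENorm_zero (A : BanachCouple 𝕜 A₀ A₁ E) (θ : ℝ) {q : ℝ≥0∞} (hq : 1 ≤ q) :
    A.realENorm θ q 0 = 0 := by
  simpa using A.realENorm_smul_le θ hq 0 0

theorem realENorm_smul (A : BanachCouple 𝕜 A₀ A₁ E) (θ : ℝ) {q : ℝ≥0∞} (hq : 1 ≤ q)
    (c : 𝕜) (x : A.sum) : A.realENorm θ q (c • x) = ‖c‖ₑ * A.realENorm θ q x := by
  by_cases hc : c = 0
  · subst hc
    simp [A.realENorm_zero θ hq]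
  refine le_antisymm (A.realENorm_smul_le θ hq c x) ?_
  have hc0 : ‖c‖ₑ ≠ 0 := by simpa using hc
  calc ‖c‖ₑ * A.realENorm θ q x = ‖c‖ₑ * A.realENorm θ q (c⁻¹ • c • x) := by
        rw [smul_smul, inv_mul_cancel₀ hc, one_smul]
    _ ≤ ‖c‖ₑ * (‖c⁻¹‖ₑ * A.realENorm θ q (c • x)) := by
        gcongr
        exact A.realENorm_smul_le θ hq _ _
    _ = A.realENorm θ q (c • x) := by
        rw [enorm_inv hc, ← mul_assoc, ENNReal.mul_inv_cancel hc0 enorm_ne_top, one_mul]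

theorem eq_zero_of_realENorm_eq_zero (A : BanachCouple 𝕜 A₀ A₁ E) {θ : ℝ} {q : ℝ≥0∞} (hq : 1 ≤ q)
    {x : A.sum} (h : A.realENorm θ q x = 0) : x = 0 := by
  obtain ⟨t, ht, h0⟩ :=
    exists_eq_zero_of_weightedNorm_eq_zero θ hq (A.measurable_peetreK x) h
  exact A.eq_zero_of_peetreK_eq_zero ht h0

/-- The elements of `A₀ + A₁` that belong to `(A₀, A₁)_{θ,q}`. -/
def realSubmodule (A : BanachCouple 𝕜 A₀ A₁ E) (θ : ℝ) (q : ℝ≥0∞) [Fact (1 ≤ q)] :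
    Submodule 𝕜 A.sum where
  carrier := {x | A.realENorm θ q x < ∞}
  zero_mem' := by
    change A.realENorm θ q 0 < ∞
    simp [A.realENorm_zero θ (Fact.out : 1 ≤ q)]
  add_mem' {x y} hx hy :=
    (A.realENorm_add_le θ Fact.out x y).trans_lt (ENNReal.add_lt_top.mpr ⟨hx, hy⟩)
  smul_mem' c x hx :=
    (A.realENorm_smul_le θ Fact.out c x).trans_lt (ENNReal.mul_lt_top enorm_lt_top hx)

/-- The real interpolation space `(A₀, A₁)_{θ,q}`, as a type of its own: it carries the
interpolation norm and not the topology of the ambient space. -/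
def RealInterp (A : BanachCouple 𝕜 A₀ A₁ E) (θ : ℝ) (q : ℝ≥0∞) [Fact (1 ≤ q)] : Type _ :=
  ↥(A.realSubmodule θ q)

namespace RealInterp

variable {A : BanachCouple 𝕜 A₀ A₁ E} {θ : ℝ} {q : ℝ≥0∞} [Fact (1 ≤ q)]

instance : AddCommGroup (A.RealInterp θ q) := inferInstanceAs (AddCommGroup (A.realSubmodule θ q))

instance : Module 𝕜 (A.RealInterp θ q) := inferInstanceAs (Module 𝕜 (A.realSubmodule θ q))

/-- The inclusion of `(A₀, A₁)_{θ,q}` in `A₀ + A₁`. -/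
def toSum : A.RealInterp θ q →ₗ[𝕜] A.sum := (A.realSubmodule θ q).subtype

/-- An element of `A₀ + A₁` of finite interpolation norm, as an element of `(A₀, A₁)_{θ,q}`. -/
def mk (x : A.sum) (hx : x ∈ A.realSubmodule θ q) : A.RealInterp θ q := ⟨x, hx⟩

theorem toSum_injective : Function.Injective (toSum : A.RealInterp θ q →ₗ[𝕜] A.sum) :=
  Subtype.val_injective

theorem realENorm_toSum_ne_top (x : A.RealInterp θ q) : A.realENorm θ q (toSum x) ≠ ∞ :=
  (x.2 : A.realENorm θ q _ < ∞).ne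

instance : Norm (A.RealInterp θ q) where
  norm x := (A.realENorm θ q (toSum x)).toReal

theorem norm_def (x : A.RealInterp θ q) : ‖x‖ = (A.realENorm θ q (toSum x)).toReal := rfl

theorem core : NormedSpace.Core 𝕜 (A.RealInterp θ q) where
  norm_nonneg _ := ENNReal.toReal_nonneg
  norm_smul c x := by
    rw [norm_def, norm_def, map_smul, A.realENorm_smul θ Fact.out, ENNReal.toReal_mul,
      toReal_enorm]
  norm_triangle x y := by
    rw [norm_def, norm_def, norm_def, map_add,
      ← ENNReal.toReal_add (realENorm_toSum_ne_top x) (realENorm_toSum_ne_top y)]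
    exact ENNReal.toReal_mono
      (ENNReal.add_ne_top.mpr ⟨realENorm_toSum_ne_top x, realENorm_toSum_ne_top y⟩)
      (A.realENorm_add_le θ Fact.out _ _)
  norm_eq_zero_iff x := by
    rw [norm_def, ENNReal.toReal_eq_zero_iff, or_iff_left (realENorm_toSum_ne_top x)]
    constructor
    · intro h
      exact toSum_injective ((A.eq_zero_of_realENorm_eq_zero Fact.out h).trans (map_zero _).symm)
    · rintro rfl
      rw [map_zero, A.realENorm_zero θ Fact.out]

instance : NormedAddCommGroup (A.RealInterp θ q) := NormedAddCommGroup.ofCore (𝕜 := 𝕜) core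

instance : NormedSpace 𝕜 (A.RealInterp θ q) := NormedSpace.ofCore (𝕜 := 𝕜) core

end RealInterp

end

section

variable {𝕜 X₀ X₁ E Y₀ Y₁ F : Type*} [RCLike 𝕜]
  [NormedAddCommGroup X₀] [NormedSpace 𝕜 X₀] [CompleteSpace X₀]
  [NormedAddCommGroup X₁] [NormedSpace 𝕜 X₁] [CompleteSpace X₁]
  [AddCommGroup E] [Module 𝕜 E] [TopologicalSpace E] [IsTopologicalAddGroup E]
  [ContinuousSMul 𝕜 E] [T2Space E]
  [NormedAddCommGroup Y₀] [NormedSpace 𝕜 Y₀] [CompleteSpace Y₀]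
  [NormedAddCommGroup Y₁] [NormedSpace 𝕜 Y₁] [CompleteSpace Y₁]
  [AddCommGroup F] [Module 𝕜 F] [TopologicalSpace F] [IsTopologicalAddGroup F]
  [ContinuousSMul 𝕜 F] [T2Space F]

/-- A bounded linear operator `T : (X₀, X₁) → (Y₀, Y₁)` between couples: a linear map
`X₀ + X₁ → Y₀ + Y₁` whose restrictions to `X₀` and `X₁` are bounded operators `X₀ → Y₀` and
`X₁ → Y₁`. -/
structure Operator (X : BanachCouple 𝕜 X₀ X₁ E) (Y : BanachCouple 𝕜 Y₀ Y₁ F) where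
  toLinearMap : X.sum →ₗ[𝕜] Y.sum
  restr₀ : X₀ →L[𝕜] Y₀
  restr₁ : X₁ →L[𝕜] Y₁
  map_incl₀ : ∀ x : X₀, toLinearMap (X.incl₀ x) = Y.incl₀ (restr₀ x)
  map_incl₁ : ∀ x : X₁, toLinearMap (X.incl₁ x) = Y.incl₁ (restr₁ x)

namespace Operator

variable {X : BanachCouple 𝕜 X₀ X₁ E} {Y : BanachCouple 𝕜 Y₀ Y₁ F}

theorem peetreK_map_le (T : Operator X Y) (t : ℝ) (x : X.sum) :
    Y.peetreK t (T.toLinearMap x) ≤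
      ENNReal.ofReal (‖T.restr₀‖ + ‖T.restr₁‖ + 1) * X.peetreK t x := by
  have hC : 0 < ‖T.restr₀‖ + ‖T.restr₁‖ + 1 := by positivity
  have hC0 : ENNReal.ofReal (‖T.restr₀‖ + ‖T.restr₁‖ + 1) ≠ 0 := by simpa using hC
  conv_rhs => unfold peetreK
  simp only [ENNReal.mul_iInf_of_ne hC0 ENNReal.ofReal_ne_top]
  refine le_iInf₂ fun a ha => ?_
  have h : Y.incl₀ (T.restr₀ a.1) + Y.incl₁ (T.restr₁ a.2) = T.toLinearMap x := by
    rw [← T.map_incl₀, ← T.map_incl₁, ← map_add, ha]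
  have h0 : ‖T.restr₀ a.1‖ₑ ≤ ENNReal.ofReal (‖T.restr₀‖ + ‖T.restr₁‖ + 1) * ‖a.1‖ₑ := by
    rw [← ofReal_norm, ← ofReal_norm, ← ENNReal.ofReal_mul hC.le]
    refine ENNReal.ofReal_le_ofReal ((T.restr₀.le_opNorm a.1).trans ?_)
    gcongr
    linarith [norm_nonneg T.restr₁]
  have h1 : ‖T.restr₁ a.2‖ₑ ≤ ENNReal.ofReal (‖T.restr₀‖ + ‖T.restr₁‖ + 1) * ‖a.2‖ₑ := by
    rw [← ofReal_norm, ← ofReal_norm, ← ENNReal.ofReal_mul hC.le]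
    refine ENNReal.ofReal_le_ofReal ((T.restr₁.le_opNorm a.2).trans ?_)
    gcongr
    linarith [norm_nonneg T.restr₀]
  calc Y.peetreK t (T.toLinearMap x)
      ≤ ‖T.restr₀ a.1‖ₑ + ENNReal.ofReal t * ‖T.restr₁ a.2‖ₑ := Y.peetreK_le t h
    _ ≤ _ := add_le_add h0 (mul_le_mul_right h1 _)
    _ = _ := by ring

theorem realENorm_map_le (T : Operator X Y) (θ : ℝ) {q : ℝ≥0∞} (hq : 1 ≤ q) (x : X.sum) :
    Y.realENorm θ q (T.toLinearMap x) ≤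
      ENNReal.ofReal (‖T.restr₀‖ + ‖T.restr₁‖ + 1) * X.realENorm θ q x :=
  (weightedNorm_mono θ q fun t _ => T.peetreK_map_le t x).trans
    (weightedNorm_const_mul θ hq _ ENNReal.ofReal_ne_top).le

theorem map_mem_realSubmodule (T : Operator X Y) (θ : ℝ) (q : ℝ≥0∞) [Fact (1 ≤ q)] {x : X.sum}
    (hx : x ∈ X.realSubmodule θ q) : T.toLinearMap x ∈ Y.realSubmodule θ q :=
  (T.realENorm_map_le θ Fact.out x).trans_lt (ENNReal.mul_lt_top ENNReal.ofReal_lt_top hx)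

/-- The restriction `T_θ : (X₀, X₁)_{θ,q} → (Y₀, Y₁)_{θ,q}` of `T`. -/
def interp (T : Operator X Y) (θ : ℝ) (q : ℝ≥0∞) [Fact (1 ≤ q)] :
    X.RealInterp θ q →L[𝕜] Y.RealInterp θ q :=
  LinearMap.mkContinuous
    { toFun := fun x =>
        RealInterp.mk (T.toLinearMap (RealInterp.toSum x)) (T.map_mem_realSubmodule θ q x.2)
      map_add' := fun x y => RealInterp.toSum_injective
        ((congrArg T.toLinearMap (map_add _ x y)).trans (map_add _ _ _))
      map_smul' := fun c x => RealInterp.toSum_injective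
        ((congrArg T.toLinearMap (map_smul _ c x)).trans (map_smul _ _ _)) }
    (‖T.restr₀‖ + ‖T.restr₁‖ + 1) fun x => by
      have h := ENNReal.toReal_mono
        (ENNReal.mul_ne_top ENNReal.ofReal_ne_top (RealInterp.realENorm_toSum_ne_top x))
        (T.realENorm_map_le θ (Fact.out : 1 ≤ q) (RealInterp.toSum x))
      rwa [ENNReal.toReal_mul, ENNReal.toReal_ofReal (by positivity)] at h

theorem toSum_interp (T : Operator X Y) (θ : ℝ) (q : ℝ≥0∞) [Fact (1 ≤ q)] (x : X.RealInterp θ q) :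
    RealInterp.toSum (T.interp θ q x) = T.toLinearMap (RealInterp.toSum x) := rfl

/-- `I` is an interval in `(0, 1)` and `T_θ` is invertible (an isomorphism with bounded inverse) for
every `θ ∈ I`. The connected components of `{θ ∈ (0, 1) | T_θ is invertible}` are the largest such
intervals; neither openness nor maximality is required of `I`. -/
structure IsIntervalOfInvertibility (T : Operator X Y) (q : ℝ≥0∞) [Fact (1 ≤ q)] (I : Set ℝ) :
    Prop where
  subset : I ⊆ Ioo 0 1
  ordConnected : I.OrdConnected
  isInvertible : ∀ θ ∈ I, (T.interp θ q).IsInvertible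

end Operator

end

end BanachCouple

end

/-! Dyadic decompositions `x = a m + b m`, normalised as `u m = 2 ^ (-θ m) a m` and `v m = 2 ^ ((1 -
θ) m) b m`, turn an element of the space with parameters `θ, q` into a pair of `ℓ^q` sequences.
Conversely, a pair `p` represents an element exactly when its levels do not depend on `m`, that is,
when `(1 - S) p` lies in `zeroSeq`, where `S` is the right shift with weights `2 ^ (-θ)` and `2 ^ (1
- θ)`. Since `0 < θ < 1`, `1 - S` is invertible on pairs, so the interpolation space is the cokernel
of `1 - S` on `zeroSeq`. The Banach space `zeroSeq` is the same for all `θ`; only `S` varies.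

Surjectivity of `T_θ` thus gives surjectivity of `(u, w) ↦ T u + (1 - S) w` onto `zeroSeq`
(`surjective_zeroSeqCoprod`), a property stable under small perturbations of `S`, even to weights
that depend on `m`. The weights `r m = 2 ^ (-θ) wt m / wt (m - 1)` with `wt m = 1 + 2 ^ ((θ - θ')
m)` lie between `2 ^ (-θ)` and `2 ^ (-θ')`, hence are a small perturbation for `θ'` near `θ`, and
they describe the intersection of the spaces for `θ` and `θ'`. So `T` maps intersection onto
intersection (`exists_mem_inter_of_surjective`): a `y` in both target spaces has one preimage lying
in both source spaces, and this preimage is the value of both inverses.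

Agreement of the inverses is therefore local in the parameter. It spreads along the segment from
`θ₀` to `θ₁` by connectedness, because `y` belongs to all intermediate spaces. -/

noncomputable section

/-! ### Stability of surjectivity -/

/-- Surjectivity of a bounded operator between Banach spaces is stable under small perturbations. -/
theorem ContinuousLinearMap.exists_forall_surjective_of_surjective {𝕜 E F : Type*}
    [NontriviallyNormedField 𝕜] [NormedAddCommGroup E] [NormedSpace 𝕜 E] [CompleteSpace E]
    [NormedAddCommGroup F] [NormedSpace 𝕜 F] [CompleteSpace F] (f : E →L[𝕜] F)
    (hf : Function.Surjective f) :
    ∃ ε : ℝ, 0 < ε ∧ ∀ g : E →L[𝕜] F, (∀ x, ‖g x - f x‖ ≤ ε * ‖x‖) → Function.Surjective g := by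
  have hr : f.range = ⊤ := LinearMap.range_eq_top.mpr hf
  set s := f.nonlinearRightInverseOfSurjective hr with hs
  have hpos : 0 < s.nnnorm := f.nonlinearRightInverseOfSurjective_nnnorm_pos hr
  -- Any constant below the inverse of the bound of the right inverse would do; half of it leaves
  -- the margin `d > 0`.
  refine ⟨((s.nnnorm⁻¹ / 2 : NNReal) : ℝ), by positivity, fun g hg y => ?_⟩
  have happ : ApproximatesLinearOn g f univ (s.nnnorm⁻¹ / 2) := by
    intro x _ x' _
    have := hg (x - x')
    simpa only [map_sub] using this
  set d : ℝ := (s.nnnorm : ℝ)⁻¹ - ((s.nnnorm⁻¹ / 2 : NNReal) : ℝ) with hd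
  have hdpos : 0 < d := by
    have : (0 : ℝ) < s.nnnorm := hpos
    rw [hd]
    push_cast
    have h2 : (0 : ℝ) < (s.nnnorm : ℝ)⁻¹ := by positivity
    linarith
  -- The radius is chosen so that the image of the ball covers the closed ball of radius `d * (‖y‖ /
  -- d) = ‖y‖` about `g 0 = 0`, which contains `y`.
  have := happ.surjOn_closedBall_of_nonlinearRightInverse s (ε := ‖y‖ / d) (b := 0)
    (by positivity) (subset_univ _)
  obtain ⟨x, -, hx⟩ := this (a := y) (by
    rw [map_zero, mem_closedBall_zero_iff, mul_div_cancel₀ _ hdpos.ne'])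
  exact ⟨x, hx⟩

/-! ### Weighted shifts on `ℓ^q(ℤ)` -/

section

variable {𝕜 E F : Type*} [RCLike 𝕜] [NormedAddCommGroup E] [NormedSpace 𝕜 E]
  [NormedAddCommGroup F] [NormedSpace 𝕜 F] {q : ℝ≥0∞} [Fact (1 ≤ q)]

theorem Memℓp.comp_equiv {f : ℤ → E} (hf : Memℓp f q) (e : ℤ ≃ ℤ) :
    Memℓp (fun m => f (e m)) q := by
  have h0 : q ≠ 0 := (zero_lt_one.trans_le (Fact.out : 1 ≤ q)).ne'
  rcases q.trichotomy with h | rfl | h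
  · exact absurd h h0
  · rw [memℓp_infty_iff] at hf ⊢
    refine hf.mono ?_
    rintro _ ⟨m, rfl⟩
    exact ⟨e m, rfl⟩
  · rw [memℓp_gen_iff h] at hf ⊢
    exact e.summable_iff.mpr hf

theorem lp.norm_comp_equiv_le (f g : lp (fun _ : ℤ => E) q) (e : ℤ ≃ ℤ)
    (h : ∀ m, g m = f (e m)) : ‖g‖ ≤ ‖f‖ := by
  have h0 : q ≠ 0 := (zero_lt_one.trans_le (Fact.out : 1 ≤ q)).ne'
  rcases q.trichotomy with hq | rfl | hq
  · exact absurd hq h0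
  · refine lp.norm_le_of_forall_le (norm_nonneg _) fun m => ?_
    rw [h]
    exact lp.norm_apply_le_norm h0 f _
  · refine lp.norm_le_of_tsum_le hq (norm_nonneg _) ?_
    rw [lp.norm_rpow_eq_tsum hq]
    simp only [h]
    exact (e.tsum_eq fun m => ‖f m‖ ^ q.toReal).le

/-- The operator `f ↦ (m ↦ g m (f (e m)))` on `ℓ^q(ℤ)`. -/
def lpShift (e : ℤ ≃ ℤ) (g : ℤ → E →L[𝕜] F) (C : ℝ) (hg : ∀ m, ‖g m‖ ≤ C) :
    lp (fun _ : ℤ => E) q →L[𝕜] lp (fun _ : ℤ => F) q :=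
  LinearMap.mkContinuous
    { toFun := fun f => ⟨fun m => g m (f (e m)),
        (((lp.memℓp f).comp_equiv e).norm.const_mul C).mono fun m =>
          (g m).le_of_opNorm_le (hg m) _⟩
      map_add' := fun f f' => by
        ext m
        exact map_add (g m) _ _
      map_smul' := fun c f => by
        ext m
        exact map_smul (g m) c _ }
    C fun f => by
      have hC : 0 ≤ C := (norm_nonneg _).trans (hg 0)
      let f' : lp (fun _ : ℤ => E) q := ⟨fun m => f (e m), (lp.memℓp f).comp_equiv e⟩
      have h1 : ‖f'‖ ≤ ‖f‖ := lp.norm_comp_equiv_le f f' e fun _ => rfl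
      have h2 : ‖((C : 𝕜) • f' : lp (fun _ : ℤ => E) q)‖ ≤ C * ‖f‖ := by
        rw [norm_smul, RCLike.norm_ofReal, abs_of_nonneg hC]
        gcongr
      refine (lp.norm_mono (zero_lt_one.trans_le (Fact.out : 1 ≤ q)).ne' fun m => ?_).trans h2
      rw [lp.coeFn_smul, Pi.smul_apply, norm_smul, RCLike.norm_ofReal, abs_of_nonneg hC]
      exact (g m).le_of_opNorm_le (hg m) _

theorem norm_lpShift_le (e : ℤ ≃ ℤ) (g : ℤ → E →L[𝕜] F) (C : ℝ) (hg : ∀ m, ‖g m‖ ≤ C) :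
    ‖(lpShift e g C hg : lp (fun _ : ℤ => E) q →L[𝕜] lp (fun _ : ℤ => F) q)‖ ≤ C := by
  unfold lpShift
  exact LinearMap.mkContinuous_norm_le _ ((norm_nonneg _).trans (hg 0)) _

theorem norm_lpShift_apply_le (e : ℤ ≃ ℤ) (g : ℤ → E →L[𝕜] F) (C : ℝ) (hg : ∀ m, ‖g m‖ ≤ C)
    (f : lp (fun _ : ℤ => E) q) : ‖lpShift e g C hg f‖ ≤ C * ‖f‖ :=
  (lpShift e g C hg).le_of_opNorm_le (norm_lpShift_le e g C hg) f

theorem norm_smul_id_le_of_norm_le {r : 𝕜} {C : ℝ} (hr : ‖r‖ ≤ C) :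
    ‖r • ContinuousLinearMap.id 𝕜 E‖ ≤ C := by
  refine ContinuousLinearMap.opNorm_le_bound _ ((norm_nonneg _).trans hr) fun x => ?_
  simp only [_root_.smul_apply, ContinuousLinearMap.id_apply, norm_smul]
  gcongr

/-- The weighted shift `f ↦ (m ↦ r m • f (e m))` on `ℓ^q(ℤ)`. -/
def lpWeightedShift (e : ℤ ≃ ℤ) (r : ℤ → 𝕜) (C : ℝ) (hr : ∀ m, ‖r m‖ ≤ C) :
    lp (fun _ : ℤ => E) q →L[𝕜] lp (fun _ : ℤ => E) q :=
  lpShift e (fun m => r m • ContinuousLinearMap.id 𝕜 E) C fun m => norm_smul_id_le_of_norm_le (hr m)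

@[simp]
theorem lpWeightedShift_apply (e : ℤ ≃ ℤ) (r : ℤ → 𝕜) (C : ℝ) (hr : ∀ m, ‖r m‖ ≤ C)
    (f : lp (fun _ : ℤ => E) q) (m : ℤ) : lpWeightedShift e r C hr f m = r m • f (e m) := rfl

theorem norm_lpWeightedShift_apply_le (e : ℤ ≃ ℤ) (r : ℤ → 𝕜) (C : ℝ) (hr : ∀ m, ‖r m‖ ≤ C)
    (f : lp (fun _ : ℤ => E) q) : ‖lpWeightedShift e r C hr f‖ ≤ C * ‖f‖ :=
  norm_lpShift_apply_le _ _ _ _ f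

/-- `1 - S` is onto for a weighted shift `S` with weights bounded by some `ρ < 1`. -/
theorem exists_sub_lpWeightedShift_eq [CompleteSpace E] (e : ℤ ≃ ℤ) (r : ℤ → 𝕜) {ρ : ℝ}
    (hρ : ρ < 1) (hr : ∀ m, ‖r m‖ ≤ ρ) (w : lp (fun _ : ℤ => E) q) :
    ∃ v : lp (fun _ : ℤ => E) q, ∀ m, v m - r m • v (e m) = w m := by
  have hn : ‖(lpWeightedShift e r ρ hr : lp (fun _ : ℤ => E) q →L[𝕜] lp (fun _ : ℤ => E) q)‖ < 1 :=
    (norm_lpShift_le _ _ _ _).trans_lt hρ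
  obtain ⟨u, hu⟩ := isUnit_one_sub_of_norm_lt_one hn
  refine ⟨(↑u⁻¹ : lp (fun _ : ℤ => E) q →L[𝕜] lp (fun _ : ℤ => E) q) w, fun m => ?_⟩
  have h1 : (u : lp (fun _ : ℤ => E) q →L[𝕜] lp (fun _ : ℤ => E) q)
      ((↑u⁻¹ : lp (fun _ : ℤ => E) q →L[𝕜] lp (fun _ : ℤ => E) q) w) = w := by
    rw [← mul_apply_eq_comp, Units.mul_inv, one_apply_eq_self]
  rw [hu] at h1
  conv_rhs => rw [← h1]
  rfl

/-- `1 - S` is onto for a weighted right shift `S` whose inverse weights are bounded by some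
`ρ < 1`. -/
theorem exists_sub_lpWeightedShift_eq_of_inv [CompleteSpace E] (r : ℤ → 𝕜) {ρ : ℝ}
    (hρ : ρ < 1) (h0 : ∀ m, r m ≠ 0) (hr : ∀ m, ‖(r m)⁻¹‖ ≤ ρ) (w : lp (fun _ : ℤ => E) q) :
    ∃ v : lp (fun _ : ℤ => E) q, ∀ m, v m - r m • v (m - 1) = w m := by
  -- Solving the equation for `v (m - 1)` and reindexing turns it into one for a left shift with the
  -- inverse weights, which is a contraction.
  let S := lpWeightedShift (E := E) (q := q) (Equiv.addRight (1 : ℤ)) (fun m => (r (m + 1))⁻¹) ρ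
    fun m => hr (m + 1)
  obtain ⟨v, hv⟩ := exists_sub_lpWeightedShift_eq (Equiv.addRight (1 : ℤ))
    (fun m => (r (m + 1))⁻¹) hρ (fun m => hr (m + 1)) (-S w)
  refine ⟨v, fun m => ?_⟩
  have h := hv (m - 1)
  have h2 : (-S w : lp (fun _ : ℤ => E) q) (m - 1) = -((r m)⁻¹ • w m) := by
    rw [lp.coeFn_neg, Pi.neg_apply, lpWeightedShift_apply]
    simp
  rw [h2] at h
  simp only [Equiv.coe_addRight, sub_add_cancel] at h
  have h3 : v (m - 1) = (r m)⁻¹ • v m - (r m)⁻¹ • w m := by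
    rw [sub_eq_iff_eq_add] at h
    rw [h]
    abel
  rw [h3, smul_sub, smul_inv_smul₀ (h0 m), smul_inv_smul₀ (h0 m)]
  abel

end

/-! ### Dyadic discretization of the weighted norm -/

theorem Ioi_zero_eq_iUnion_Ico_two_zpow :
    Ioi (0 : ℝ) = ⋃ m : ℤ, Ico ((2 : ℝ) ^ m) ((2 : ℝ) ^ (m + 1)) := by
  ext t
  simp only [mem_Ioi, mem_iUnion]
  constructor
  · intro ht
    exact exists_mem_Ico_zpow ht one_lt_two
  · rintro ⟨m, hm⟩
    exact (zpow_pos two_pos m).trans_le hm.1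

theorem pairwise_disjoint_Ico_two_zpow :
    Pairwise (Function.onFun Disjoint fun m : ℤ => Ico ((2 : ℝ) ^ m) ((2 : ℝ) ^ (m + 1))) :=
  (zpow_right_mono₀ (one_le_two : (1 : ℝ) ≤ 2)).pairwise_disjoint_on_Ico_succ

section Discretization

variable {F : ℝ → ℝ≥0∞} {a : ℤ → ℝ≥0∞}

theorem iSup_pos_ne_top_iff_of_dyadic
    (h1 : ∀ m : ℤ, ∀ t ∈ Ico ((2 : ℝ) ^ m) ((2 : ℝ) ^ (m + 1)), F t ≤ 2 * a m)
    (h2 : ∀ m : ℤ, ∀ t ∈ Ico ((2 : ℝ) ^ m) ((2 : ℝ) ^ (m + 1)), a m ≤ 2 * F t) :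
    (⨆ (t : ℝ) (_ : 0 < t), F t) ≠ ∞ ↔ (⨆ m, a m) ≠ ∞ := by
  constructor
  · intro h
    refine ne_top_of_le_ne_top (ENNReal.mul_ne_top (ENNReal.ofNat_ne_top (n := 2)) h)
      (iSup_le fun m => ?_)
    refine (h2 m ((2 : ℝ) ^ m) ⟨le_rfl, zpow_lt_zpow_right₀ one_lt_two (lt_add_one m)⟩).trans ?_
    gcongr
    exact le_iSup₂ (f := fun (t : ℝ) (_ : 0 < t) => F t) _ (zpow_pos two_pos m)
  · intro h
    refine ne_top_of_le_ne_top (ENNReal.mul_ne_top (ENNReal.ofNat_ne_top (n := 2)) h)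
      (iSup₂_le fun t ht => ?_)
    obtain ⟨m, hm⟩ := exists_mem_Ico_zpow ht (one_lt_two : (1 : ℝ) < 2)
    refine (h1 m t hm).trans ?_
    gcongr
    exact le_iSup a m

theorem setLIntegral_const_div_Ico_two_zpow (m : ℤ) (c : ℝ≥0∞) :
    ∫⁻ _ in Ico ((2 : ℝ) ^ m) ((2 : ℝ) ^ (m + 1)), c / ENNReal.ofReal ((2 : ℝ) ^ m) = c := by
  have hm : (0 : ℝ) < 2 ^ m := zpow_pos two_pos m
  rw [setLIntegral_const, Real.volume_Ico, zpow_add_one₀ two_ne_zero]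
  rw [show (2 : ℝ) ^ m * 2 - 2 ^ m = 2 ^ m by ring]
  exact ENNReal.div_mul_cancel (by simpa using hm) ENNReal.ofReal_ne_top

/-- On a dyadic block `t` is within a factor `2` of `2 ^ m`, and the block has length `2 ^ m`, so
each block contributes `a m ^ p` up to constants independent of `m`. -/
theorem lintegral_ne_top_iff_of_dyadic {p : ℝ} (hp : 0 < p)
    (h1 : ∀ m : ℤ, ∀ t ∈ Ico ((2 : ℝ) ^ m) ((2 : ℝ) ^ (m + 1)), F t ≤ 2 * a m)
    (h2 : ∀ m : ℤ, ∀ t ∈ Ico ((2 : ℝ) ^ m) ((2 : ℝ) ^ (m + 1)), a m ≤ 2 * F t) :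
    (∫⁻ t in Ioi (0 : ℝ), F t ^ p / ENNReal.ofReal t) ≠ ∞ ↔ (∑' m, a m ^ p) ≠ ∞ := by
  have h2p : (2 : ℝ≥0∞) ^ p ≠ ∞ := ENNReal.rpow_ne_top_of_nonneg hp.le ENNReal.ofNat_ne_top
  rw [Ioi_zero_eq_iUnion_Ico_two_zpow,
    lintegral_iUnion (fun _ => measurableSet_Ico) pairwise_disjoint_Ico_two_zpow]
  constructor
  · intro h
    have hle : ∀ m : ℤ, a m ^ p ≤ (2 * 2 ^ p) *
        ∫⁻ t in Ico ((2 : ℝ) ^ m) ((2 : ℝ) ^ (m + 1)), F t ^ p / ENNReal.ofReal t := by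
      intro m
      rw [← lintegral_const_mul' _ _ (ENNReal.mul_ne_top ENNReal.ofNat_ne_top h2p),
        ← setLIntegral_const_div_Ico_two_zpow m (a m ^ p)]
      refine setLIntegral_mono' measurableSet_Ico fun t ht => ?_
      have ht2 : t ≤ 2 * 2 ^ m := by
        have := ht.2.le
        rwa [zpow_add_one₀ two_ne_zero, mul_comm] at this
      have hm : (0 : ℝ) < 2 ^ m := zpow_pos two_pos m
      have ht0 : 0 < t := hm.trans_le ht.1
      have hinv : (ENNReal.ofReal ((2 : ℝ) ^ m))⁻¹ ≤ 2 * (ENNReal.ofReal t)⁻¹ := by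
        rw [← ENNReal.ofReal_inv_of_pos hm, ← ENNReal.ofReal_inv_of_pos ht0,
          show (2 : ℝ≥0∞) = ENNReal.ofReal 2 by simp, ← ENNReal.ofReal_mul two_pos.le]
        refine ENNReal.ofReal_le_ofReal ?_
        rw [inv_le_comm₀ hm (by positivity), mul_inv, inv_inv]
        linarith
      calc a m ^ p / ENNReal.ofReal ((2 : ℝ) ^ m)
          ≤ (2 * F t) ^ p * (2 * (ENNReal.ofReal t)⁻¹) := by
            rw [div_eq_mul_inv]
            gcongr
            exact h2 m t ht
        _ = _ := by
            rw [ENNReal.mul_rpow_of_nonneg _ _ hp.le, div_eq_mul_inv]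
            ring
    refine ne_top_of_le_ne_top ?_ (ENNReal.tsum_le_tsum hle)
    rw [ENNReal.tsum_mul_left]
    exact ENNReal.mul_ne_top (ENNReal.mul_ne_top ENNReal.ofNat_ne_top h2p) h
  · intro h
    have hle : ∀ m : ℤ, ∫⁻ t in Ico ((2 : ℝ) ^ m) ((2 : ℝ) ^ (m + 1)), F t ^ p / ENNReal.ofReal t
        ≤ 2 ^ p * a m ^ p := by
      intro m
      rw [← ENNReal.mul_rpow_of_nonneg _ _ hp.le,
        ← setLIntegral_const_div_Ico_two_zpow m ((2 * a m) ^ p)]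
      refine setLIntegral_mono' measurableSet_Ico fun t ht => ?_
      exact ENNReal.div_le_div (ENNReal.rpow_le_rpow (h1 m t ht) hp.le)
        (ENNReal.ofReal_le_ofReal ht.1)
    refine ne_top_of_le_ne_top ?_ (ENNReal.tsum_le_tsum hle)
    rw [ENNReal.tsum_mul_left]
    exact ENNReal.mul_ne_top h2p h

end Discretization

theorem memℓp_toReal_iff_of_one_le {a : ℤ → ℝ≥0∞} (ha : ∀ m, a m ≠ ∞) {q : ℝ≥0∞} (hq : 1 ≤ q) :
    Memℓp (fun m => (a m).toReal) q ↔
      if q = ∞ then (⨆ m, a m) ≠ ∞ else (∑' m, a m ^ q.toReal) ≠ ∞ := by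
  split_ifs with h
  · subst h
    rw [memℓp_infty_iff]
    simp only [Real.norm_eq_abs, ENNReal.abs_toReal]
    constructor
    · rintro ⟨C, hC⟩
      refine ne_top_of_le_ne_top (ENNReal.ofReal_ne_top (r := C)) (iSup_le fun m => ?_)
      rw [← ENNReal.ofReal_toReal (ha m)]
      exact ENNReal.ofReal_le_ofReal (hC ⟨m, rfl⟩)
    · intro h
      refine ⟨(⨆ m, a m).toReal, ?_⟩
      rintro _ ⟨m, rfl⟩
      exact ENNReal.toReal_mono h (le_iSup a m)
  · have hq0 : 0 < q.toReal := ENNReal.toReal_pos (zero_lt_one.trans_le hq).ne' h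
    rw [memℓp_gen_iff hq0]
    simp only [Real.norm_eq_abs, ENNReal.abs_toReal]
    constructor
    · intro hs
      have : ∀ m, a m ^ q.toReal = ENNReal.ofReal ((a m).toReal ^ q.toReal) := fun m => by
        rw [ENNReal.toReal_rpow, ENNReal.ofReal_toReal]
        exact ENNReal.rpow_ne_top_of_nonneg hq0.le (ha m)
      simp only [this]
      exact hs.tsum_ofReal_ne_top
    · intro hs
      have := ENNReal.summable_toReal hs
      simpa only [ENNReal.toReal_rpow] using this

/-- Discretization of the weighted norm of a quasi-concave function. -/
theorem weightedNorm_ne_top_iff_memℓp {θ : ℝ} (hθ : θ ∈ Ioo (0 : ℝ) 1) {q : ℝ≥0∞} (hq : 1 ≤ q)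
    {g : ℝ → ℝ≥0∞} (hg : Monotone g) (hg2 : ∀ t, 0 < t → g (2 * t) ≤ 2 * g t)
    (hfin : ∀ t, 0 < t → g t ≠ ∞) :
    weightedNorm θ q g ≠ ∞ ↔
      Memℓp (fun m : ℤ => (2 : ℝ) ^ (-θ * m) * (g ((2 : ℝ) ^ m)).toReal) q := by
  set a : ℤ → ℝ≥0∞ := fun m => ENNReal.ofReal (((2 : ℝ) ^ m) ^ (-θ)) * g ((2 : ℝ) ^ m) with ha
  have hpos : ∀ m : ℤ, (0 : ℝ) < 2 ^ m := fun m => zpow_pos two_pos m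
  have hafin : ∀ m, a m ≠ ∞ := fun m => ENNReal.mul_ne_top ENNReal.ofReal_ne_top (hfin _ (hpos m))
  have hareal : (fun m : ℤ => (2 : ℝ) ^ (-θ * m) * (g ((2 : ℝ) ^ m)).toReal)
      = fun m => (a m).toReal := by
    funext m
    rw [ha, ENNReal.toReal_mul, ENNReal.toReal_ofReal (by positivity)]
    congr 1
    rw [mul_comm, Real.rpow_mul two_pos.le, Real.rpow_intCast]
  rw [hareal, memℓp_toReal_iff_of_one_le hafin hq]
  have h1 : ∀ m : ℤ, ∀ t ∈ Ico ((2 : ℝ) ^ m) ((2 : ℝ) ^ (m + 1)),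
      ENNReal.ofReal (t ^ (-θ)) * g t ≤ 2 * a m := by
    intro m t ht
    have hw : t ^ (-θ) ≤ ((2 : ℝ) ^ m) ^ (-θ) :=
      Real.rpow_le_rpow_of_nonpos (hpos m) ht.1 (by linarith [hθ.1])
    have hgt : g t ≤ 2 * g ((2 : ℝ) ^ m) := by
      refine (hg ?_).trans (hg2 _ (hpos m))
      have := ht.2.le
      rwa [zpow_add_one₀ two_ne_zero, mul_comm] at this
    calc ENNReal.ofReal (t ^ (-θ)) * g t
        ≤ ENNReal.ofReal (((2 : ℝ) ^ m) ^ (-θ)) * (2 * g ((2 : ℝ) ^ m)) := by gcongr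
      _ = 2 * a m := by rw [ha]; ring
  have h2 : ∀ m : ℤ, ∀ t ∈ Ico ((2 : ℝ) ^ m) ((2 : ℝ) ^ (m + 1)),
      a m ≤ 2 * (ENNReal.ofReal (t ^ (-θ)) * g t) := by
    intro m t ht
    have ht0 : 0 < t := (hpos m).trans_le ht.1
    have hw : ((2 : ℝ) ^ m) ^ (-θ) ≤ 2 * t ^ (-θ) := by
      have ht2 : t ≤ 2 ^ m * 2 := by
        have := ht.2.le
        rwa [zpow_add_one₀ two_ne_zero] at this
      have h3 : ((2 : ℝ) ^ m * 2) ^ (-θ) ≤ t ^ (-θ) :=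
        Real.rpow_le_rpow_of_nonpos ht0 ht2 (by linarith [hθ.1])
      rw [Real.mul_rpow (hpos m).le two_pos.le] at h3
      -- With `θ < 1`, the weight drops by at most a factor `2` across a block.
      have h4 : (2 : ℝ) ^ (-1 : ℝ) ≤ 2 ^ (-θ) :=
        Real.rpow_le_rpow_of_exponent_le one_le_two (by linarith [hθ.2])
      rw [Real.rpow_neg_one] at h4
      have h5 : (0 : ℝ) < ((2 : ℝ) ^ m) ^ (-θ) := Real.rpow_pos_of_pos (hpos m) _
      nlinarith
    calc a m ≤ ENNReal.ofReal (2 * t ^ (-θ)) * g t := by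
          rw [ha]
          exact mul_le_mul' (ENNReal.ofReal_le_ofReal hw) (hg ht.1)
      _ = 2 * (ENNReal.ofReal (t ^ (-θ)) * g t) := by
          rw [ENNReal.ofReal_mul two_pos.le, ENNReal.ofReal_ofNat]
          ring
  unfold weightedNorm
  split_ifs with h
  · exact iSup_pos_ne_top_iff_of_dyadic h1 h2
  · have hq0 : 0 < q.toReal := ENNReal.toReal_pos (zero_lt_one.trans_le hq).ne' h
    rw [Ne, ENNReal.rpow_eq_top_iff_of_pos (by positivity)]
    exact lintegral_ne_top_iff_of_dyadic hq0 h1 h2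

/-! ### Sequence description of the real interpolation spaces -/

/-- The scalar `2 ^ (s m)`. -/
def dyadicWeight (𝕜 : Type*) [RCLike 𝕜] (s : ℝ) (m : ℤ) : 𝕜 := (((2 : ℝ) ^ (s * m) : ℝ) : 𝕜)

section

variable {𝕜 : Type*} [RCLike 𝕜]

theorem norm_dyadicWeight (s : ℝ) (m : ℤ) : ‖dyadicWeight 𝕜 s m‖ = (2 : ℝ) ^ (s * m) := by
  rw [dyadicWeight, RCLike.norm_ofReal, abs_of_pos (by positivity)]

theorem dyadicWeight_ne_zero (s : ℝ) (m : ℤ) : dyadicWeight 𝕜 s m ≠ 0 := by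
  rw [← norm_ne_zero_iff, norm_dyadicWeight]
  positivity

theorem dyadicWeight_mul (s t : ℝ) (m : ℤ) :
    dyadicWeight 𝕜 s m * dyadicWeight 𝕜 t m = dyadicWeight 𝕜 (s + t) m := by
  rw [dyadicWeight, dyadicWeight, dyadicWeight, ← RCLike.ofReal_mul, ← Real.rpow_add two_pos,
    add_mul]

theorem dyadicWeight_zero (m : ℤ) : dyadicWeight 𝕜 0 m = 1 := by
  simp [dyadicWeight]

theorem dyadicWeight_sub_one (s : ℝ) (m : ℤ) :
    dyadicWeight 𝕜 s (m - 1) = (((2 : ℝ) ^ (-s) : ℝ) : 𝕜) * dyadicWeight 𝕜 s m := by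
  rw [dyadicWeight, dyadicWeight, ← RCLike.ofReal_mul, ← Real.rpow_add two_pos]
  congr 2
  push_cast
  ring

end

namespace BanachCouple

variable {𝕜 A₀ A₁ E : Type*} [RCLike 𝕜]
  [NormedAddCommGroup A₀] [NormedSpace 𝕜 A₀] [CompleteSpace A₀]
  [NormedAddCommGroup A₁] [NormedSpace 𝕜 A₁] [CompleteSpace A₁]
  [AddCommGroup E] [Module 𝕜 E] [TopologicalSpace E] [IsTopologicalAddGroup E]
  [ContinuousSMul 𝕜 E] [T2Space E]

theorem exists_incl_add_incl_eq (A : BanachCouple 𝕜 A₀ A₁ E) (x : A.sum) :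
    ∃ a : A₀ × A₁, A.incl₀ a.1 + A.incl₁ a.2 = x := by
  obtain ⟨_, ⟨a, rfl⟩, _, ⟨b, rfl⟩, h⟩ := Submodule.mem_sup.mp x.2
  exact ⟨(a, b), Subtype.ext h⟩

theorem peetreK_ne_top (A : BanachCouple 𝕜 A₀ A₁ E) (t : ℝ) (x : A.sum) : A.peetreK t x ≠ ∞ := by
  obtain ⟨a, ha⟩ := A.exists_incl_add_incl_eq x
  exact ne_top_of_le_ne_top
    (ENNReal.add_ne_top.mpr ⟨enorm_ne_top, ENNReal.mul_ne_top ENNReal.ofReal_ne_top enorm_ne_top⟩)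
    (A.peetreK_le t ha)

theorem peetreK_mono (A : BanachCouple 𝕜 A₀ A₁ E) (x : A.sum) :
    Monotone fun t => A.peetreK t x := by
  intro s t hst
  refine le_iInf₂ fun a ha => (A.peetreK_le s ha).trans ?_
  gcongr

theorem peetreK_two_mul_le (A : BanachCouple 𝕜 A₀ A₁ E) (t : ℝ) (x : A.sum) :
    A.peetreK (2 * t) x ≤ 2 * A.peetreK t x := by
  conv_rhs => unfold peetreK
  simp only [ENNReal.mul_iInf_of_ne two_ne_zero ENNReal.ofNat_ne_top]
  refine le_iInf₂ fun a ha => (A.peetreK_le (2 * t) ha).trans ?_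
  rw [ENNReal.ofReal_mul two_pos.le, ENNReal.ofReal_ofNat, mul_add, ← mul_assoc]
  exact add_le_add_left (le_mul_of_one_le_left bot_le one_le_two) _

theorem mem_realSubmodule_iff_memℓp (A : BanachCouple 𝕜 A₀ A₁ E) {θ : ℝ}
    (hθ : θ ∈ Ioo (0 : ℝ) 1) {q : ℝ≥0∞} [Fact (1 ≤ q)] (x : A.sum) :
    x ∈ A.realSubmodule θ q ↔
      Memℓp (fun m : ℤ => (2 : ℝ) ^ (-θ * m) * (A.peetreK ((2 : ℝ) ^ m) x).toReal) q := by
  rw [← weightedNorm_ne_top_iff_memℓp hθ Fact.out (A.peetreK_mono x)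
    (fun t _ => A.peetreK_two_mul_le t x) (fun t _ => A.peetreK_ne_top t x)]
  exact (lt_top_iff_ne_top (α := ℝ≥0∞))

theorem toReal_peetreK_two_zpow_le (A : BanachCouple 𝕜 A₀ A₁ E) (m : ℤ) {x : A.sum} {a : A₀}
    {b : A₁} (h : A.incl₀ a + A.incl₁ b = x) :
    (A.peetreK ((2 : ℝ) ^ m) x).toReal ≤ ‖a‖ + 2 ^ m * ‖b‖ := by
  refine ENNReal.toReal_le_of_le_ofReal (by positivity) ((A.peetreK_le _ h).trans_eq ?_)
  rw [ENNReal.ofReal_add (by positivity) (by positivity), ENNReal.ofReal_mul (by positivity),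
    ofReal_norm, ofReal_norm]

/-- A choice of nearly optimal decompositions at all dyadic levels. -/
theorem exists_near_optimal (A : BanachCouple 𝕜 A₀ A₁ E) (x : A.sum) :
    ∃ (a : ℤ → A₀) (b : ℤ → A₁), (∀ m, A.incl₀ (a m) + A.incl₁ (b m) = x) ∧
      ∀ m, ‖a m‖ + 2 ^ m * ‖b m‖ ≤ 2 * (A.peetreK ((2 : ℝ) ^ m) x).toReal := by
  have key : ∀ m : ℤ, ∃ a : A₀ × A₁, A.incl₀ a.1 + A.incl₁ a.2 = x ∧
      ‖a.1‖ + 2 ^ m * ‖a.2‖ ≤ 2 * (A.peetreK ((2 : ℝ) ^ m) x).toReal := by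
    intro m
    have hm : (0 : ℝ) < 2 ^ m := zpow_pos two_pos m
    -- A decomposition within a factor `2` of the infimum needs `K < 2 * K`, hence `K ≠ 0`; the zero
    -- element is decomposed trivially.
    by_cases hx : x = 0
    · exact ⟨0, by simp [hx], by simp⟩
    · set K := A.peetreK ((2 : ℝ) ^ m) x with hK
      have hK0 : K ≠ 0 := fun h => hx (A.eq_zero_of_peetreK_eq_zero hm h)
      have hKt : K ≠ ∞ := A.peetreK_ne_top _ x
      have hlt : K < 2 * K := by
        rw [two_mul]
        exact ENNReal.lt_add_right hKt hK0
      obtain ⟨a, ha⟩ := iInf_lt_iff.mp (hK ▸ hlt)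
      obtain ⟨ha', hlt'⟩ := iInf_lt_iff.mp ha
      refine ⟨a, ha', ?_⟩
      have := ENNReal.toReal_mono (ENNReal.mul_ne_top ENNReal.ofNat_ne_top hKt) hlt'.le
      rwa [ENNReal.toReal_add enorm_ne_top (ENNReal.mul_ne_top ENNReal.ofReal_ne_top enorm_ne_top),
        ENNReal.toReal_mul, ENNReal.toReal_mul, toReal_enorm, toReal_enorm,
        ENNReal.toReal_ofReal hm.le, ENNReal.toReal_ofNat] at this
  choose a ha using key
  exact ⟨fun m => (a m).1, fun m => (a m).2, fun m => (ha m).1, fun m => (ha m).2⟩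

theorem two_rpow_one_sub_mul (θ : ℝ) (m : ℤ) :
    (2 : ℝ) ^ ((1 - θ) * m) = 2 ^ (-θ * m) * 2 ^ m := by
  rw [← Real.rpow_intCast 2 m, ← Real.rpow_add two_pos]
  congr 1
  ring

theorem memℓp_of_mem_realSubmodule (A : BanachCouple 𝕜 A₀ A₁ E) {θ : ℝ}
    (hθ : θ ∈ Ioo (0 : ℝ) 1) {q : ℝ≥0∞} [Fact (1 ≤ q)] {x : A.sum}
    (hx : x ∈ A.realSubmodule θ q) {a : ℤ → A₀} {b : ℤ → A₁}
    (h : ∀ m, ‖a m‖ + 2 ^ m * ‖b m‖ ≤ 2 * (A.peetreK ((2 : ℝ) ^ m) x).toReal) :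
    Memℓp (fun m : ℤ => dyadicWeight 𝕜 (-θ) m • a m) q ∧
      Memℓp (fun m : ℤ => dyadicWeight 𝕜 (1 - θ) m • b m) q := by
  have hg := ((A.mem_realSubmodule_iff_memℓp hθ x).mp hx).const_mul 2
  have key : ∀ m : ℤ, (2 : ℝ) ^ (-θ * m) * (‖a m‖ + 2 ^ m * ‖b m‖) ≤
      2 * ((2 : ℝ) ^ (-θ * m) * (A.peetreK ((2 : ℝ) ^ m) x).toReal) := by
    intro m
    rw [mul_left_comm]
    exact mul_le_mul_of_nonneg_left (h m) (by positivity)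
  constructor
  · refine hg.mono fun m => le_trans ?_ (key m)
    rw [norm_smul, norm_dyadicWeight]
    gcongr
    exact le_add_of_nonneg_right (by positivity)
  · refine hg.mono fun m => le_trans ?_ (key m)
    rw [norm_smul, norm_dyadicWeight, two_rpow_one_sub_mul, mul_assoc]
    gcongr
    exact le_add_of_nonneg_left (by positivity)

/-- Every decomposition bounds `K` from above, so near optimality is not needed in this direction.
-/
theorem mem_realSubmodule_of_memℓp (A : BanachCouple 𝕜 A₀ A₁ E) {θ : ℝ}
    (hθ : θ ∈ Ioo (0 : ℝ) 1) {q : ℝ≥0∞} [Fact (1 ≤ q)] {x : A.sum} {a : ℤ → A₀} {b : ℤ → A₁}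
    (h : ∀ m, A.incl₀ (a m) + A.incl₁ (b m) = x)
    (ha : Memℓp (fun m : ℤ => dyadicWeight 𝕜 (-θ) m • a m) q)
    (hb : Memℓp (fun m : ℤ => dyadicWeight 𝕜 (1 - θ) m • b m) q) : x ∈ A.realSubmodule θ q := by
  rw [A.mem_realSubmodule_iff_memℓp hθ]
  refine (ha.norm.add hb.norm).mono fun m => ?_
  rw [Pi.add_apply, norm_smul, norm_smul, norm_dyadicWeight, norm_dyadicWeight,
    two_rpow_one_sub_mul, norm_mul, Real.norm_of_nonneg (by positivity),
    Real.norm_of_nonneg ENNReal.toReal_nonneg, mul_assoc, ← mul_add]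
  gcongr
  exact A.toReal_peetreK_two_zpow_le m (h m)

/-- `(A₀, A₁)_{θ,q} ∩ (A₀, A₁)_{θ',q}` is contained in the intermediate spaces. -/
theorem mem_realSubmodule_of_mem_uIcc (A : BanachCouple 𝕜 A₀ A₁ E) {θ₀ θ₁ θ : ℝ} {q : ℝ≥0∞}
    [Fact (1 ≤ q)] (h₀ : θ₀ ∈ Ioo (0 : ℝ) 1) (h₁ : θ₁ ∈ Ioo (0 : ℝ) 1) (hθ : θ ∈ uIcc θ₀ θ₁)
    {x : A.sum} (hx₀ : x ∈ A.realSubmodule θ₀ q) (hx₁ : x ∈ A.realSubmodule θ₁ q) :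
    x ∈ A.realSubmodule θ q := by
  have h : θ ∈ Ioo (0 : ℝ) 1 := (ordConnected_Ioo.uIcc_subset h₀ h₁) hθ
  rw [A.mem_realSubmodule_iff_memℓp h]
  rw [A.mem_realSubmodule_iff_memℓp h₀] at hx₀
  rw [A.mem_realSubmodule_iff_memℓp h₁] at hx₁
  refine (hx₀.add hx₁).mono fun m => ?_
  rw [norm_mul, Real.norm_of_nonneg (by positivity), Real.norm_of_nonneg ENNReal.toReal_nonneg,
    Pi.add_apply, ← add_mul]
  gcongr
  -- The exponent stays between the two extreme ones whatever the sign of `m`, so the intermediate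
  -- weight is at most the sum of the extreme weights.
  have hmem : -θ * m ∈ uIcc (-θ₀ * m) (-θ₁ * m) := by
    rcases mem_uIcc.mp hθ with ⟨h3, h4⟩ | ⟨h3, h4⟩ <;> rcases le_total (0 : ℝ) m with h5 | h5 <;>
      rw [mem_uIcc] <;> [right; left; left; right] <;> constructor <;> nlinarith
  have hp : ∀ s : ℝ, (0 : ℝ) < 2 ^ s := fun s => Real.rpow_pos_of_pos two_pos s
  rcases mem_uIcc.mp hmem with ⟨-, h4⟩ | ⟨-, h4⟩
  · have := Real.rpow_le_rpow_of_exponent_le one_le_two h4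
    linarith [hp (-θ₀ * m)]
  · have := Real.rpow_le_rpow_of_exponent_le one_le_two h4
    linarith [hp (-θ₁ * m)]

end BanachCouple

/-! ### Pairs of sequences and invertibility of `1 - S` -/

section

variable {𝕜 E : Type*} [RCLike 𝕜] [NormedAddCommGroup E] [NormedSpace 𝕜 E]
  {q : ℝ≥0∞} [Fact (1 ≤ q)]

theorem lp_eq_zero_of_eq_smul (e : ℤ ≃ ℤ) (r : ℤ → 𝕜) {ρ : ℝ} (hρ : ρ < 1) (hr : ∀ m, ‖r m‖ ≤ ρ)
    {v : lp (fun _ : ℤ => E) q} (hv : ∀ m, v m = r m • v (e m)) : v = 0 := by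
  have h1 : lpWeightedShift e r ρ hr v = v := by
    ext m
    exact (hv m).symm
  have h2 := norm_lpWeightedShift_apply_le e r ρ hr v
  rw [h1] at h2
  have h3 := norm_nonneg v
  exact norm_eq_zero.mp (by nlinarith)

theorem lp_eq_zero_of_eq_smul_of_inv (r : ℤ → 𝕜) {ρ : ℝ} (hρ : ρ < 1) (h0 : ∀ m, r m ≠ 0)
    (hr : ∀ m, ‖(r m)⁻¹‖ ≤ ρ) {v : lp (fun _ : ℤ => E) q} (hv : ∀ m, v m = r m • v (m - 1)) :
    v = 0 := by
  refine lp_eq_zero_of_eq_smul (Equiv.addRight (1 : ℤ)) (fun m => (r (m + 1))⁻¹) hρ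
    (fun m => hr _) fun m => ?_
  rw [Equiv.coe_addRight, hv (m + 1), add_sub_cancel_right, inv_smul_smul₀ (h0 _)]

end

/-- Pairs of `ℓ^q` sequences. -/
abbrev SeqPair (A₀ A₁ : Type*) [NormedAddCommGroup A₀] [NormedAddCommGroup A₁] (q : ℝ≥0∞) :=
  lp (fun _ : ℤ => A₀) q × lp (fun _ : ℤ => A₁) q

section

variable {𝕜 A₀ A₁ : Type*} [RCLike 𝕜] [NormedAddCommGroup A₀] [NormedSpace 𝕜 A₀]
  [NormedAddCommGroup A₁] [NormedSpace 𝕜 A₁] {q : ℝ≥0∞} [Fact (1 ≤ q)]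

theorem norm_two_mul_ofReal_le {r δ : ℝ} (hr : |r| ≤ δ) : ‖(2 * (r : 𝕜))‖ ≤ 2 * δ := by
  rw [norm_mul, RCLike.norm_ofNat, RCLike.norm_ofReal]
  gcongr

theorem norm_ofReal_le {r δ : ℝ} (hr : |r| ≤ δ) : ‖(r : 𝕜)‖ ≤ δ := by
  rwa [RCLike.norm_ofReal]

/-- The operator `(u, v) ↦ (m ↦ r m • u (m - 1), m ↦ 2 * r m • v (m - 1))`. -/
def pairShift (𝕜 : Type*) [RCLike 𝕜] [NormedSpace 𝕜 A₀] [NormedSpace 𝕜 A₁] (r : ℤ → ℝ) (δ : ℝ)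
    (hr : ∀ m, |r m| ≤ δ) : SeqPair A₀ A₁ q →L[𝕜] SeqPair A₀ A₁ q :=
  (lpWeightedShift (Equiv.subRight (1 : ℤ)) (fun m => (r m : 𝕜)) δ
    fun m => norm_ofReal_le (hr m)).prodMap
  (lpWeightedShift (Equiv.subRight (1 : ℤ)) (fun m => 2 * (r m : 𝕜)) (2 * δ)
    fun m => norm_two_mul_ofReal_le (hr m))

theorem pairShift_fst_apply (r : ℤ → ℝ) (δ : ℝ) (hr : ∀ m, |r m| ≤ δ) (p : SeqPair A₀ A₁ q)
    (m : ℤ) : (pairShift 𝕜 r δ hr p).1 m = (r m : 𝕜) • p.1 (m - 1) := rfl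

theorem pairShift_snd_apply (r : ℤ → ℝ) (δ : ℝ) (hr : ∀ m, |r m| ≤ δ) (p : SeqPair A₀ A₁ q)
    (m : ℤ) : (pairShift 𝕜 r δ hr p).2 m = (2 * (r m : 𝕜)) • p.2 (m - 1) := rfl

theorem norm_pairShift_apply_le (r : ℤ → ℝ) (δ : ℝ) (hr : ∀ m, |r m| ≤ δ) (p : SeqPair A₀ A₁ q) :
    ‖pairShift 𝕜 r δ hr p‖ ≤ 2 * δ * ‖p‖ := by
  have hδ : 0 ≤ δ := (abs_nonneg _).trans (hr 0)
  refine max_le ?_ ?_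
  · calc ‖(pairShift 𝕜 r δ hr p).1‖ ≤ δ * ‖p.1‖ :=
        norm_lpWeightedShift_apply_le _ _ _ (fun m => norm_ofReal_le (hr m)) _
      _ ≤ δ * ‖p‖ := by gcongr; exact norm_fst_le p
      _ ≤ 2 * δ * ‖p‖ := by
        have := mul_nonneg hδ (norm_nonneg p)
        linarith
  · calc ‖(pairShift 𝕜 r δ hr p).2‖ ≤ 2 * δ * ‖p.2‖ :=
        norm_lpWeightedShift_apply_le _ _ _ (fun m => norm_two_mul_ofReal_le (hr m)) _
      _ ≤ 2 * δ * ‖p‖ := by gcongr; exact norm_snd_le p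

/-- Linearity in the weights is what makes the shift depend continuously, in operator norm, on their
supremum distance. -/
theorem pairShift_sub_pairShift (r s : ℤ → ℝ) {δ δ' δ'' : ℝ} (hr : ∀ m, |r m| ≤ δ)
    (hs : ∀ m, |s m| ≤ δ') (h : ∀ m, |r m - s m| ≤ δ'') (p : SeqPair A₀ A₁ q) :
    pairShift 𝕜 r δ hr p - pairShift 𝕜 s δ' hs p = pairShift 𝕜 (fun m => r m - s m) δ'' h p := by
  refine Prod.ext ?_ ?_ <;> ext m
  · change (r m : 𝕜) • p.1 (m - 1) - (s m : 𝕜) • p.1 (m - 1)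
      = ((r m - s m : ℝ) : 𝕜) • p.1 (m - 1)
    rw [RCLike.ofReal_sub, sub_smul]
  · change (2 * (r m : 𝕜)) • p.2 (m - 1) - (2 * (s m : 𝕜)) • p.2 (m - 1)
      = (2 * ((r m - s m : ℝ) : 𝕜)) • p.2 (m - 1)
    rw [RCLike.ofReal_sub, mul_sub, sub_smul]

theorem norm_inv_two_mul_ofReal_le {r ρ : ℝ} (hr : 1 ≤ 2 * (r * ρ)) (hr0 : 0 < r) :
    ‖(2 * (r : 𝕜))⁻¹‖ ≤ ρ := by
  rw [norm_inv, norm_mul, RCLike.norm_ofNat, RCLike.norm_ofReal, abs_of_pos hr0,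
    inv_le_iff_one_le_mul₀ (by positivity)]
  linarith

/-- For weights `r` strictly between `1 / 2` and `1`, uniformly in `m`, the shift contracts the
first component, while on the second its weights `2 * r` have inverses bounded by `ρ < 1`. A Neumann
series applies to each. -/
theorem exists_sub_pairShift_eq [CompleteSpace A₀] [CompleteSpace A₁] (r : ℤ → ℝ) {δ ρ : ℝ}
    (hr : ∀ m, |r m| ≤ δ) (hρ : ρ < 1) (h0 : ∀ m, 0 < r m) (h1 : ∀ m, r m ≤ ρ)
    (h2 : ∀ m, 1 ≤ 2 * (r m * ρ)) (z : SeqPair A₀ A₁ q) :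
    ∃ k : SeqPair A₀ A₁ q, k - pairShift 𝕜 r δ hr k = z := by
  obtain ⟨u, hu⟩ := exists_sub_lpWeightedShift_eq (𝕜 := 𝕜) (Equiv.subRight (1 : ℤ))
    (fun m => (r m : 𝕜)) hρ (fun m => norm_ofReal_le (by rw [abs_of_pos (h0 m)]; exact h1 m)) z.1
  obtain ⟨v, hv⟩ := exists_sub_lpWeightedShift_eq_of_inv (𝕜 := 𝕜) (fun m => 2 * (r m : 𝕜)) hρ
    (fun m => mul_ne_zero two_ne_zero (RCLike.ofReal_ne_zero.mpr (h0 m).ne'))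
    (fun m => norm_inv_two_mul_ofReal_le (h2 m) (h0 m)) z.2
  refine ⟨(u, v), Prod.ext ?_ ?_⟩ <;> ext m
  · exact hu m
  · exact hv m

theorem eq_of_sub_pairShift_eq (r : ℤ → ℝ) {δ ρ : ℝ}
    (hr : ∀ m, |r m| ≤ δ) (hρ : ρ < 1) (h0 : ∀ m, 0 < r m) (h1 : ∀ m, r m ≤ ρ)
    (h2 : ∀ m, 1 ≤ 2 * (r m * ρ)) {k l : SeqPair A₀ A₁ q}
    (h : k - pairShift 𝕜 r δ hr k = l - pairShift 𝕜 r δ hr l) : k = l := by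
  have h3 : k - l = pairShift 𝕜 r δ hr (k - l) := by
    rw [map_sub, ← sub_eq_zero]
    rw [← sub_eq_zero] at h
    rw [← h]
    abel
  rw [← sub_eq_zero]
  refine Prod.ext ?_ ?_
  · refine lp_eq_zero_of_eq_smul (𝕜 := 𝕜) (Equiv.subRight (1 : ℤ)) (fun m => (r m : 𝕜)) hρ
      (fun m => norm_ofReal_le (by rw [abs_of_pos (h0 m)]; exact h1 m)) fun m => ?_
    conv_lhs => rw [h3]
    rfl
  · refine lp_eq_zero_of_eq_smul_of_inv (𝕜 := 𝕜) (fun m => 2 * (r m : 𝕜)) hρ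
      (fun m => mul_ne_zero two_ne_zero (RCLike.ofReal_ne_zero.mpr (h0 m).ne'))
      (fun m => norm_inv_two_mul_ofReal_le (h2 m) (h0 m)) fun m => ?_
    conv_lhs => rw [h3]
    rfl

end

/-! ### Levels and the space of pairs representing zero -/

namespace BanachCouple

section

variable {𝕜 A₀ A₁ E : Type*} [RCLike 𝕜]
  [NormedAddCommGroup A₀] [NormedSpace 𝕜 A₀] [CompleteSpace A₀]
  [NormedAddCommGroup A₁] [NormedSpace 𝕜 A₁] [CompleteSpace A₁]
  [AddCommGroup E] [Module 𝕜 E] [TopologicalSpace E] [IsTopologicalAddGroup E]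
  [ContinuousSMul 𝕜 E] [T2Space E]

/-- The element of `A₀ + A₁` represented at level `m` by a pair of sequences weighted by
`2 ^ (-θ m)` and `2 ^ ((1 - θ) m)`. -/
def levelSum (A : BanachCouple 𝕜 A₀ A₁ E) (θ : ℝ) (u : ℤ → A₀) (v : ℤ → A₁) (m : ℤ) : A.sum :=
  dyadicWeight 𝕜 θ m • A.incl₀ (u m) + dyadicWeight 𝕜 (θ - 1) m • A.incl₁ (v m)

/-- Changing `θ` rescales each level by a nonzero scalar, so vanishing of the levels does not depend
on `θ`. -/
theorem levelSum_eq_smul (A : BanachCouple 𝕜 A₀ A₁ E) (θ : ℝ) (u : ℤ → A₀) (v : ℤ → A₁) (m : ℤ) :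
    A.levelSum θ u v m = dyadicWeight 𝕜 θ m • A.levelSum 0 u v m := by
  rw [levelSum, levelSum, smul_add, smul_smul, smul_smul, dyadicWeight_mul, dyadicWeight_mul,
    add_zero, zero_sub, sub_eq_add_neg]

theorem levelSum_sub (A : BanachCouple 𝕜 A₀ A₁ E) (θ : ℝ) (u u' : ℤ → A₀) (v v' : ℤ → A₁) (m : ℤ) :
    A.levelSum θ (u - u') (v - v') m = A.levelSum θ u v m - A.levelSum θ u' v' m := by
  simp only [levelSum, Pi.sub_apply, map_sub, smul_sub]
  abel

theorem levelSum_smul (A : BanachCouple 𝕜 A₀ A₁ E) (θ : ℝ) (c : ℤ → 𝕜) (u : ℤ → A₀) (v : ℤ → A₁)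
    (m : ℤ) :
    A.levelSum θ (fun m => c m • u m) (fun m => c m • v m) m = c m • A.levelSum θ u v m := by
  simp only [levelSum, map_smul, smul_add]
  rw [smul_comm (c m), smul_comm (c m)]

/-- Constancy of the levels of `p` thus becomes vanishing of the levels of `(1 - S) p`. -/
theorem levelSum_sub_levelSum_pred (A : BanachCouple 𝕜 A₀ A₁ E) (θ : ℝ) (u : ℤ → A₀) (v : ℤ → A₁)
    (m : ℤ) :
    A.levelSum θ u v m - A.levelSum θ u v (m - 1) =
      A.levelSum θ (fun m => u m - (((2 : ℝ) ^ (-θ) : ℝ) : 𝕜) • u (m - 1))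
        (fun m => v m - (2 * (((2 : ℝ) ^ (-θ) : ℝ) : 𝕜)) • v (m - 1)) m := by
  have h2 : (((2 : ℝ) ^ (-(θ - 1)) : ℝ) : 𝕜) = 2 * (((2 : ℝ) ^ (-θ) : ℝ) : 𝕜) := by
    rw [show -(θ - 1) = 1 + -θ by ring, Real.rpow_add two_pos, Real.rpow_one, RCLike.ofReal_mul,
      RCLike.ofReal_ofNat]
  simp only [levelSum, dyadicWeight_sub_one, h2, map_sub, map_smul, smul_sub, mul_smul]
  simp only [smul_comm (dyadicWeight 𝕜 θ m), smul_comm (dyadicWeight 𝕜 (θ - 1) m)]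
  abel

/-- The closed subspace of pairs of sequences which represent `0` at all levels. -/
def zeroSeq (A : BanachCouple 𝕜 A₀ A₁ E) (q : ℝ≥0∞) [Fact (1 ≤ q)] :
    Submodule 𝕜 (SeqPair A₀ A₁ q) where
  carrier := {p | ∀ m, A.levelSum 0 p.1 p.2 m = 0}
  zero_mem' m := by simp [levelSum]
  add_mem' {p p'} hp hp' m := by
    have := congrArg₂ (· + ·) (hp m) (hp' m)
    simp only [levelSum, add_zero] at this
    rw [← this]
    simp only [levelSum, Prod.fst_add, Prod.snd_add, lp.coeFn_add, Pi.add_apply, map_add, smul_add]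
    abel
  smul_mem' c p hp m := by
    have := A.levelSum_smul 0 (fun _ => c) p.1 p.2 m
    rw [hp m, smul_zero] at this
    exact this

variable {q : ℝ≥0∞} [Fact (1 ≤ q)]

theorem mem_zeroSeq_iff (A : BanachCouple 𝕜 A₀ A₁ E) (p : SeqPair A₀ A₁ q) :
    p ∈ A.zeroSeq q ↔ ∀ m, A.levelSum 0 p.1 p.2 m = 0 := Iff.rfl

/-- The embeddings into the Hausdorff ambient space are continuous. The resulting completeness is
needed for the stability of surjectivity. -/
theorem isClosed_zeroSeq (A : BanachCouple 𝕜 A₀ A₁ E) :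
    IsClosed (A.zeroSeq q : Set (SeqPair A₀ A₁ q)) := by
  have h : (A.zeroSeq q : Set (SeqPair A₀ A₁ q)) =
      ⋂ m : ℤ, {p : SeqPair A₀ A₁ q | dyadicWeight 𝕜 0 m • A.ι₀ (p.1 m) +
        dyadicWeight 𝕜 (0 - 1) m • A.ι₁ (p.2 m) = 0} := by
    ext p
    simp only [SetLike.mem_coe, mem_zeroSeq_iff, mem_iInter]
    exact forall_congr' fun m => Subtype.ext_iff
  rw [h]
  refine isClosed_iInter fun m => isClosed_eq ?_ continuous_const
  have h0 : Continuous fun p : SeqPair A₀ A₁ q => p.1 m :=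
    (lp.evalCLM 𝕜 (fun _ : ℤ => A₀) q m).continuous.comp continuous_fst
  have h1 : Continuous fun p : SeqPair A₀ A₁ q => p.2 m :=
    (lp.evalCLM 𝕜 (fun _ : ℤ => A₁) q m).continuous.comp continuous_snd
  exact ((A.ι₀.continuous.comp h0).const_smul _).add ((A.ι₁.continuous.comp h1).const_smul _)

instance (A : BanachCouple 𝕜 A₀ A₁ E) : CompleteSpace (A.zeroSeq q) :=
  A.isClosed_zeroSeq.completeSpace_coe

theorem levelSum_eq_zero_of_mem (A : BanachCouple 𝕜 A₀ A₁ E) {p : SeqPair A₀ A₁ q}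
    (hp : p ∈ A.zeroSeq q) (θ : ℝ) (m : ℤ) : A.levelSum θ p.1 p.2 m = 0 := by
  rw [levelSum_eq_smul, hp m, smul_zero]

theorem mem_zeroSeq_of_levelSum_eq_zero (A : BanachCouple 𝕜 A₀ A₁ E) {p : SeqPair A₀ A₁ q} (θ : ℝ)
    (h : ∀ m, A.levelSum θ p.1 p.2 m = 0) : p ∈ A.zeroSeq q := fun m => by
  have := h m
  rw [levelSum_eq_smul] at this
  exact (smul_eq_zero.mp this).resolve_left (dyadicWeight_ne_zero _ _)

/-- The factor `2` on the second component matches the ratio of consecutive dyadic weights, so level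
`m` of the image is `r m` times level `m - 1`. This holds for arbitrary weights `r`, which allows
the perturbation. -/
theorem pairShift_mem_zeroSeq (A : BanachCouple 𝕜 A₀ A₁ E) (r : ℤ → ℝ) {δ : ℝ}
    (hr : ∀ m, |r m| ≤ δ) {p : SeqPair A₀ A₁ q} (hp : p ∈ A.zeroSeq q) :
    pairShift 𝕜 r δ hr p ∈ A.zeroSeq q := by
  intro m
  have h := congrArg ((r m : 𝕜) • ·) (hp (m - 1))
  have h2 : (((2 : ℝ) ^ (-(0 - 1) : ℝ) : ℝ) : 𝕜) = 2 := by
    norm_num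
    exact RCLike.ofReal_ofNat 2
  simp only [levelSum, smul_add, smul_zero, dyadicWeight_sub_one, h2] at h
  rw [← h]
  simp only [levelSum, pairShift_fst_apply, pairShift_snd_apply, map_smul, smul_smul,
    dyadicWeight_zero]
  congr 2
  · simp
  · ring

/-- The restriction of `pairShift` to `zeroSeq`. -/
def zeroSeqShift (A : BanachCouple 𝕜 A₀ A₁ E) (q : ℝ≥0∞) [Fact (1 ≤ q)] (r : ℤ → ℝ) (δ : ℝ)
    (hr : ∀ m, |r m| ≤ δ) : A.zeroSeq q →L[𝕜] A.zeroSeq q :=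
  ((pairShift 𝕜 r δ hr).comp (A.zeroSeq q).subtypeL).codRestrict (A.zeroSeq q)
    fun p => A.pairShift_mem_zeroSeq r hr p.2

/-- A sequence of levels whose differences vanish represents a single element. -/
theorem exists_forall_levelSum_eq (A : BanachCouple 𝕜 A₀ A₁ E) (θ : ℝ) {u : ℤ → A₀} {v : ℤ → A₁}
    (h : ∀ m, A.levelSum θ (fun m => u m - (((2 : ℝ) ^ (-θ) : ℝ) : 𝕜) • u (m - 1))
        (fun m => v m - (2 * (((2 : ℝ) ^ (-θ) : ℝ) : 𝕜)) • v (m - 1)) m = 0) :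
    ∃ x, ∀ m, A.levelSum θ u v m = x := by
  have hs : ∀ m, A.levelSum θ u v m = A.levelSum θ u v (m - 1) := fun m => by
    rw [← sub_eq_zero, levelSum_sub_levelSum_pred, h]
  refine ⟨A.levelSum θ u v 0, fun m => ?_⟩
  induction m using Int.induction_on with
  | zero => rfl
  | succ n ih => rw [hs, add_sub_cancel_right, ih]
  | pred n ih => rw [← hs, ih]

/-- On both components the normalisations for `θ` and `θ'` differ by the same factor `2 ^ ((θ - θ')
m)`. -/
theorem mem_realSubmodule_of_levelSum_eq (A : BanachCouple 𝕜 A₀ A₁ E) {θ θ' : ℝ}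
    (hθ' : θ' ∈ Ioo (0 : ℝ) 1) {x : A.sum} {u : ℤ → A₀} {v : ℤ → A₁}
    (h : ∀ m, A.levelSum θ u v m = x)
    (hu : Memℓp (fun m : ℤ => dyadicWeight 𝕜 (θ - θ') m • u m) q)
    (hv : Memℓp (fun m : ℤ => dyadicWeight 𝕜 (θ - θ') m • v m) q) : x ∈ A.realSubmodule θ' q := by
  refine A.mem_realSubmodule_of_memℓp hθ' (a := fun m => dyadicWeight 𝕜 θ m • u m)
    (b := fun m => dyadicWeight 𝕜 (θ - 1) m • v m) (fun m => ?_) ?_ ?_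
  · rw [map_smul, map_smul, ← h m, levelSum]
  · convert hu using 2 with m
    rw [smul_smul, dyadicWeight_mul, neg_add_eq_sub]
  · convert hv using 2 with m
    rw [smul_smul, dyadicWeight_mul]
    congr 2
    ring

/-- Every `x` has representing sequences which lie in `ℓ^q` with the weights of each space
`(A₀, A₁)_{θ,q}` that contains `x`. -/
theorem exists_levelSum_eq (A : BanachCouple 𝕜 A₀ A₁ E) (x : A.sum) (θ : ℝ) :
    ∃ (u : ℤ → A₀) (v : ℤ → A₁), (∀ m, A.levelSum θ u v m = x) ∧
      ∀ θ' ∈ Ioo (0 : ℝ) 1, x ∈ A.realSubmodule θ' q →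
        Memℓp (fun m : ℤ => dyadicWeight 𝕜 (θ - θ') m • u m) q ∧
        Memℓp (fun m : ℤ => dyadicWeight 𝕜 (θ - θ') m • v m) q := by
  -- Near optimality does not involve the parameter, so one choice of decompositions serves every
  -- `θ'` at once.
  obtain ⟨a, b, hab, hle⟩ := A.exists_near_optimal x
  refine ⟨fun m => dyadicWeight 𝕜 (-θ) m • a m, fun m => dyadicWeight 𝕜 (1 - θ) m • b m,
    fun m => ?_, fun θ' hθ' hx => ?_⟩
  · rw [levelSum, map_smul, map_smul, smul_smul, smul_smul, dyadicWeight_mul, dyadicWeight_mul,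
      add_neg_cancel, sub_add_sub_cancel, sub_self, dyadicWeight_zero, one_smul, one_smul, hab]
  · have := A.memℓp_of_mem_realSubmodule hθ' hx hle
    simp only [smul_smul, dyadicWeight_mul]
    rwa [show θ - θ' + -θ = -θ' by ring, show θ - θ' + (1 - θ) = 1 - θ' by ring]

end

end BanachCouple

/-! ### Operators on pairs and the local lifting -/

theorem abs_two_rpow_neg_le_one {θ : ℝ} (hθ : 0 < θ) : |(2 : ℝ) ^ (-θ)| ≤ 1 := by
  rw [abs_of_pos (by positivity)]
  exact Real.rpow_le_one_of_one_le_of_nonpos one_le_two (by linarith)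

/-- Between `2 ^ (-θ)` and `2 ^ (-θ')` the numbers stay away from `1 / 2` and `1`. -/
theorem exists_bound_two_rpow_neg {θ θ' : ℝ} (hθ : θ ∈ Ioo (0 : ℝ) 1) (hθ' : θ' ∈ Ioo (0 : ℝ) 1) :
    ∃ ρ : ℝ, ρ < 1 ∧ ∀ r ∈ uIcc ((2 : ℝ) ^ (-θ)) ((2 : ℝ) ^ (-θ')),
      0 < r ∧ r ≤ ρ ∧ 1 ≤ 2 * (r * ρ) := by
  have hlt : ∀ s ∈ Ioo (0 : ℝ) 1, (2 : ℝ) ^ (-s) ∈ Ioo (2⁻¹ : ℝ) 1 := fun s hs => by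
    refine ⟨?_, Real.rpow_lt_one_of_one_lt_of_neg one_lt_two (by linarith [hs.1])⟩
    rw [← Real.rpow_neg_one]
    exact Real.rpow_lt_rpow_of_exponent_lt one_lt_two (by linarith [hs.2])
  set M := max ((2 : ℝ) ^ (-θ)) ((2 : ℝ) ^ (-θ'))
  set N := min ((2 : ℝ) ^ (-θ)) ((2 : ℝ) ^ (-θ'))
  have hM : M < 1 := max_lt (hlt θ hθ).2 (hlt θ' hθ').2
  have hN : 2⁻¹ < N := lt_min (hlt θ hθ).1 (hlt θ' hθ').1
  have hN0 : 0 < N := by linarith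
  -- `M` bounds the weights on the first component, `(2 * N)⁻¹` the inverse weights on the second.
  refine ⟨max M (2 * N)⁻¹, max_lt hM (inv_lt_one_of_one_lt₀ (by linarith)), fun r hr => ?_⟩
  have h1 : N ≤ r := hr.1
  have h2 : r ≤ M := hr.2
  refine ⟨hN0.trans_le h1, h2.trans (le_max_left _ _), ?_⟩
  calc (1 : ℝ) = 2 * (N * (2 * N)⁻¹) := by field_simp
    _ ≤ 2 * (r * max M (2 * N)⁻¹) := by
      have hr0 : 0 ≤ r := hN0.le.trans h1
      gcongr
      exact le_max_right M (2 * N)⁻¹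

namespace BanachCouple.Operator

variable {𝕜 X₀ X₁ E Y₀ Y₁ F : Type*} [RCLike 𝕜]
  [NormedAddCommGroup X₀] [NormedSpace 𝕜 X₀] [CompleteSpace X₀]
  [NormedAddCommGroup X₁] [NormedSpace 𝕜 X₁] [CompleteSpace X₁]
  [AddCommGroup E] [Module 𝕜 E] [TopologicalSpace E] [IsTopologicalAddGroup E]
  [ContinuousSMul 𝕜 E] [T2Space E]
  [NormedAddCommGroup Y₀] [NormedSpace 𝕜 Y₀] [CompleteSpace Y₀]
  [NormedAddCommGroup Y₁] [NormedSpace 𝕜 Y₁] [CompleteSpace Y₁]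
  [AddCommGroup F] [Module 𝕜 F] [TopologicalSpace F] [IsTopologicalAddGroup F]
  [ContinuousSMul 𝕜 F] [T2Space F]
  {X : BanachCouple 𝕜 X₀ X₁ E} {Y : BanachCouple 𝕜 Y₀ Y₁ F} {q : ℝ≥0∞} [Fact (1 ≤ q)]

/-- The termwise action of an operator on pairs of sequences. -/
def seqMap (T : Operator X Y) (q : ℝ≥0∞) [Fact (1 ≤ q)] : SeqPair X₀ X₁ q →L[𝕜] SeqPair Y₀ Y₁ q :=
  (lpShift (Equiv.refl ℤ) (fun _ => T.restr₀) ‖T.restr₀‖ fun _ => le_rfl).prodMap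
    (lpShift (Equiv.refl ℤ) (fun _ => T.restr₁) ‖T.restr₁‖ fun _ => le_rfl)

theorem map_levelSum (T : Operator X Y) (θ : ℝ) (u : ℤ → X₀) (v : ℤ → X₁) (m : ℤ) :
    T.toLinearMap (X.levelSum θ u v m) =
      Y.levelSum θ (fun m => T.restr₀ (u m)) (fun m => T.restr₁ (v m)) m := by
  simp only [levelSum, map_add, map_smul, T.map_incl₀, T.map_incl₁]

theorem seqMap_mem_zeroSeq (T : Operator X Y) {p : SeqPair X₀ X₁ q} (hp : p ∈ X.zeroSeq q) :
    T.seqMap q p ∈ Y.zeroSeq q := fun m => by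
  have := congrArg T.toLinearMap (hp m)
  rwa [map_levelSum, map_zero] at this

/-- The operator `(u, w) ↦ T u + (1 - S) w`, with `S` the weighted shift with weights `r`. -/
def zeroSeqCoprod (T : Operator X Y) (q : ℝ≥0∞) [Fact (1 ≤ q)] (r : ℤ → ℝ) (δ : ℝ)
    (hr : ∀ m, |r m| ≤ δ) : X.zeroSeq q × Y.zeroSeq q →L[𝕜] Y.zeroSeq q :=
  (((T.seqMap q).comp (X.zeroSeq q).subtypeL).codRestrict (Y.zeroSeq q)
    fun p => T.seqMap_mem_zeroSeq p.2).coprod (ContinuousLinearMap.id 𝕜 _ - Y.zeroSeqShift q r δ hr)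

theorem coe_zeroSeqCoprod (T : Operator X Y) (r : ℤ → ℝ) (δ : ℝ) (hr : ∀ m, |r m| ≤ δ)
    (p : X.zeroSeq q × Y.zeroSeq q) :
    (T.zeroSeqCoprod q r δ hr p : SeqPair Y₀ Y₁ q) =
      T.seqMap q (p.1 : SeqPair X₀ X₁ q) +
        ((p.2 : SeqPair Y₀ Y₁ q) - pairShift 𝕜 r δ hr (p.2 : SeqPair Y₀ Y₁ q)) := rfl

theorem seqMap_pairShift (T : Operator X Y) (r : ℤ → ℝ) (δ : ℝ) (hr : ∀ m, |r m| ≤ δ)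
    (p : SeqPair X₀ X₁ q) :
    T.seqMap q (pairShift 𝕜 r δ hr p) = pairShift 𝕜 r δ hr (T.seqMap q p) := by
  refine Prod.ext ?_ ?_ <;> ext m
  · exact map_smul T.restr₀ _ _
  · exact map_smul T.restr₁ _ _

/-- With `z = (1 - S) k`, the pair `k` represents some `y = T x`. If `p` represents `x`, then `(1 -
S) p` and `k - T p` represent zero, and `T (1 - S) p + (1 - S) (k - T p) = z` because `T` commutes
with `S`. -/
theorem surjective_zeroSeqCoprod (T : Operator X Y) {θ : ℝ} (hθ : θ ∈ Ioo (0 : ℝ) 1)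
    (hT : Function.Surjective (T.interp θ q)) :
    Function.Surjective (T.zeroSeqCoprod q (fun _ => (2 : ℝ) ^ (-θ)) 1
      fun _ => abs_two_rpow_neg_le_one hθ.1) := by
  intro z
  obtain ⟨ρ, hρ, hbound⟩ := exists_bound_two_rpow_neg hθ hθ
  have hb := hbound _ left_mem_uIcc
  set B : ∀ m : ℤ, |(2 : ℝ) ^ (-θ)| ≤ 1 := fun _ => abs_two_rpow_neg_le_one hθ.1
  obtain ⟨k, hk⟩ := exists_sub_pairShift_eq (𝕜 := 𝕜) (fun _ => (2 : ℝ) ^ (-θ)) B hρ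
    (fun _ => hb.1) (fun _ => hb.2.1) (fun _ => hb.2.2) (z : SeqPair Y₀ Y₁ q)
  obtain ⟨y, hy⟩ := Y.exists_forall_levelSum_eq θ (u := k.1) (v := k.2) fun m => by
    have := Y.levelSum_eq_zero_of_mem z.2 θ m
    rw [← hk] at this
    exact this
  have hyθ : y ∈ Y.realSubmodule θ q := by
    refine Y.mem_realSubmodule_of_levelSum_eq hθ hy ?_ ?_
    · simpa only [sub_self, dyadicWeight_zero, one_smul] using lp.memℓp k.1
    · simpa only [sub_self, dyadicWeight_zero, one_smul] using lp.memℓp k.2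
  obtain ⟨x, hx⟩ := hT (RealInterp.mk y hyθ)
  have hTx : T.toLinearMap (RealInterp.toSum x) = y := by
    rw [← toSum_interp, hx]
    rfl
  obtain ⟨u, v, huv, hmem⟩ := X.exists_levelSum_eq (q := q) (RealInterp.toSum x) θ
  have hmem' := hmem θ hθ x.2
  simp only [sub_self, dyadicWeight_zero, one_smul] at hmem'
  let p : SeqPair X₀ X₁ q := (⟨u, hmem'.1⟩, ⟨v, hmem'.2⟩)
  have hp : p - pairShift 𝕜 (fun _ => (2 : ℝ) ^ (-θ)) 1 B p ∈ X.zeroSeq q := by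
    refine X.mem_zeroSeq_of_levelSum_eq_zero θ fun m => ?_
    have := X.levelSum_sub_levelSum_pred θ u v m
    rw [huv, huv, sub_self] at this
    exact this.symm
  have hw : k - T.seqMap q p ∈ Y.zeroSeq q := by
    refine Y.mem_zeroSeq_of_levelSum_eq_zero θ fun m => ?_
    have h1 := T.map_levelSum θ u v m
    rw [huv, hTx] at h1
    have h2 := Y.levelSum_sub θ k.1 (fun m => T.restr₀ (u m)) k.2 (fun m => T.restr₁ (v m)) m
    rw [← h1, hy, sub_self] at h2
    exact h2
  refine ⟨(⟨_, hp⟩, ⟨_, hw⟩), Subtype.ext ?_⟩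
  rw [coe_zeroSeqCoprod, ← hk]
  simp only [map_sub, seqMap_pairShift]
  abel

theorem norm_zeroSeqCoprod_sub_le (T : Operator X Y) (r s : ℤ → ℝ) {δ δ' δ'' : ℝ}
    (hr : ∀ m, |r m| ≤ δ) (hs : ∀ m, |s m| ≤ δ') (h : ∀ m, |r m - s m| ≤ δ'')
    (p : X.zeroSeq q × Y.zeroSeq q) :
    ‖T.zeroSeqCoprod q s δ' hs p - T.zeroSeqCoprod q r δ hr p‖ ≤ 2 * δ'' * ‖p‖ := by
  have hδ : 0 ≤ δ'' := (abs_nonneg _).trans (h 0)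
  change ‖(T.zeroSeqCoprod q s δ' hs p : SeqPair Y₀ Y₁ q) -
    (T.zeroSeqCoprod q r δ hr p : SeqPair Y₀ Y₁ q)‖ ≤ _
  rw [coe_zeroSeqCoprod, coe_zeroSeqCoprod,
    add_sub_add_left_eq_sub, sub_sub_sub_cancel_left, pairShift_sub_pairShift r s hr hs h]
  refine (norm_pairShift_apply_le _ _ _ _).trans ?_
  gcongr
  exact norm_snd_le p

/-- If `T_θ` is onto, then for `θ'` near `θ` every element of `(Y₀, Y₁)_{θ,q} ∩ (Y₀, Y₁)_{θ',q}` is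
the image of an element of `(X₀, X₁)_{θ,q} ∩ (X₀, X₁)_{θ',q}`. -/
theorem exists_mem_inter_of_surjective (T : Operator X Y) {θ : ℝ} (hθ : θ ∈ Ioo (0 : ℝ) 1)
    (hT : Function.Surjective (T.interp θ q)) :
    ∀ᶠ θ' in 𝓝 θ, θ' ∈ Ioo (0 : ℝ) 1 → ∀ y ∈ Y.realSubmodule θ q, y ∈ Y.realSubmodule θ' q →
      ∃ x ∈ X.realSubmodule θ q, x ∈ X.realSubmodule θ' q ∧ T.toLinearMap x = y := by
  set c : ℝ := (2 : ℝ) ^ (-θ) with hc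
  have hc0 : 0 < c := by positivity
  have hc1 : ∀ _ : ℤ, |c| ≤ 1 := fun _ => abs_two_rpow_neg_le_one hθ.1
  obtain ⟨ε, hε, hstable⟩ :=
    (T.zeroSeqCoprod q (fun _ => c) 1 hc1).exists_forall_surjective_of_surjective
      (T.surjective_zeroSeqCoprod hθ hT)
  have hlim : Filter.Tendsto (fun θ' : ℝ => 2 * |c - (2 : ℝ) ^ (-θ')|) (𝓝 θ) (𝓝 0) := by
    have : ContinuousAt (fun θ' : ℝ => 2 * |c - (2 : ℝ) ^ (-θ')|) θ := by
      have : Continuous fun θ' : ℝ => (2 : ℝ) ^ (-θ') :=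
        (Real.continuous_const_rpow two_ne_zero).comp continuous_neg
      exact ((continuous_const.sub this).abs.const_mul 2).continuousAt
    simpa [ContinuousAt, hc] using this
  filter_upwards [hlim.eventually_le_const hε] with θ' hclose hθ' y hy hy'
  obtain ⟨ρ, hρ, hbound⟩ := exists_bound_two_rpow_neg hθ hθ'
  -- Relative to the normalisation for `θ`, lying in both weighted `ℓ^q` spaces means lying in `ℓ^q`
  -- after multiplication by `wt`.
  let wt : ℤ → ℝ := fun m => 1 + (2 : ℝ) ^ ((θ - θ') * m)
  have hwt1 : ∀ m, 1 ≤ wt m := fun m => le_add_of_nonneg_right (by positivity)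
  have hwt0 : ∀ m, 0 < wt m := fun m => zero_lt_one.trans_le (hwt1 m)
  have hwtk : ∀ m, (wt m : 𝕜) ≠ 0 := fun m => RCLike.ofReal_ne_zero.mpr (hwt0 m).ne'
  -- Conjugating the shift with weight `c` by multiplication by `wt` yields the shift with weights
  -- `r`.
  let r : ℤ → ℝ := fun m => c * wt m / wt (m - 1)
  have hrmem : ∀ m, r m ∈ uIcc c ((2 : ℝ) ^ (-θ')) := by
    intro m
    set s : ℝ := (2 : ℝ) ^ ((θ - θ') * ((m - 1 : ℤ) : ℝ)) with hs
    have hs0 : 0 < s := by positivity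
    have hcs : c * wt m = c + (2 : ℝ) ^ (-θ') * s := by
      simp only [wt, hc, hs]
      rw [mul_add, mul_one, ← Real.rpow_add two_pos, ← Real.rpow_add two_pos]
      congr 2
      push_cast
      ring
    -- `r m` is the mean of `c` and `2 ^ (-θ')` with weights `1` and `s`.
    have hrm : r m = (c + (2 : ℝ) ^ (-θ') * s) / (1 + s) := by
      rw [← hcs]
    have h1s : 0 < 1 + s := by positivity
    rw [hrm, mem_uIcc]
    rcases le_total c ((2 : ℝ) ^ (-θ')) with h | h
    · left
      constructor
      · rw [le_div_iff₀ h1s]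
        nlinarith
      · rw [div_le_iff₀ h1s]
        nlinarith
    · right
      constructor
      · rw [le_div_iff₀ h1s]
        nlinarith
      · rw [div_le_iff₀ h1s]
        nlinarith
  have hr0 : ∀ m, 0 < r m := fun m => (hbound _ (hrmem m)).1
  have hrρ : ∀ m, r m ≤ ρ := fun m => (hbound _ (hrmem m)).2.1
  have hrρ' : ∀ m, 1 ≤ 2 * (r m * ρ) := fun m => (hbound _ (hrmem m)).2.2
  have hr1 : ∀ m, |r m| ≤ 1 := fun m => by
    rw [abs_of_pos (hr0 m)]
    exact (hrρ m).trans hρ.le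
  have hrwt : ∀ m, (wt m : 𝕜)⁻¹ * (r m : 𝕜) = (c : 𝕜) * (wt (m - 1) : 𝕜)⁻¹ := fun m => by
    have h1 := hwtk m
    have h2 := hwtk (m - 1)
    simp only [r, RCLike.ofReal_div, RCLike.ofReal_mul]
    field_simp
  have hrwt' : ∀ m, (r m : 𝕜) * (wt (m - 1) : 𝕜) = (wt m : 𝕜) * (c : 𝕜) := fun m => by
    have h2 := hwtk (m - 1)
    simp only [r, RCLike.ofReal_div, RCLike.ofReal_mul]
    field_simp
  have hsurj : Function.Surjective (T.zeroSeqCoprod q r 1 hr1) := by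
    refine hstable _ fun p => (T.norm_zeroSeqCoprod_sub_le (fun _ => c) r hc1 hr1
      (δ'' := |c - (2 : ℝ) ^ (-θ')|) (fun m => ?_) p).trans ?_
    · rw [abs_sub_comm c (r m), abs_sub_comm c]
      exact abs_sub_left_of_mem_uIcc (hrmem m)
    · gcongr
  obtain ⟨a, b, hab, hmem⟩ := Y.exists_levelSum_eq (q := q) y θ
  have hm := hmem θ hθ hy
  have hm' := hmem θ' hθ' hy'
  simp only [sub_self, dyadicWeight_zero, one_smul] at hm
  -- This is `wt` times the representing pair of `y`; it is in `ℓ^q` because `y` lies in both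
  -- spaces.
  let k : SeqPair Y₀ Y₁ q := (⟨_, hm.1.add hm'.1⟩, ⟨_, hm.2.add hm'.2⟩)
  have hk1 : ∀ m, k.1 m = (wt m : 𝕜) • a m := fun m => by
    simp only [k, wt, Pi.add_apply, RCLike.ofReal_add, RCLike.ofReal_one, add_smul, one_smul]
    rfl
  have hk2 : ∀ m, k.2 m = (wt m : 𝕜) • b m := fun m => by
    simp only [k, wt, Pi.add_apply, RCLike.ofReal_add, RCLike.ofReal_one, add_smul, one_smul]
    rfl
  have hz : k - pairShift 𝕜 r 1 hr1 k ∈ Y.zeroSeq q := by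
    refine Y.mem_zeroSeq_of_levelSum_eq_zero θ fun m => ?_
    have h1 := Y.levelSum_sub_levelSum_pred θ a b m
    rw [hab, hab, sub_self] at h1
    have h2 := Y.levelSum_smul θ (fun m => (wt m : 𝕜))
      (fun m => a m - (c : 𝕜) • a (m - 1)) (fun m => b m - (2 * (c : 𝕜)) • b (m - 1)) m
    rw [← h1, smul_zero] at h2
    rw [← h2]
    congr 1
    · funext m
      change k.1 m - (r m : 𝕜) • k.1 (m - 1) = _
      rw [hk1, hk1, smul_smul, hrwt', smul_sub, smul_smul]
    · funext m
      change k.2 m - (2 * (r m : 𝕜)) • k.2 (m - 1) = _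
      rw [hk2, hk2, smul_smul, mul_assoc, hrwt', smul_sub, smul_smul, mul_left_comm]
  obtain ⟨⟨u, w⟩, huw⟩ := hsurj ⟨_, hz⟩
  have huw' := congrArg Subtype.val huw
  rw [coe_zeroSeqCoprod] at huw'
  simp only at huw'
  obtain ⟨l, hl⟩ := exists_sub_pairShift_eq (𝕜 := 𝕜) r hr1 hρ hr0 hrρ hrρ' (u : SeqPair X₀ X₁ q)
  -- Both sides have the same image under `1 - S` for the weights `r`, which is injective on pairs.
  have hkl : T.seqMap q l + w = k := by
    refine eq_of_sub_pairShift_eq (𝕜 := 𝕜) r hr1 hρ hr0 hrρ hrρ' ?_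
    rw [← huw', ← hl, map_sub, seqMap_pairShift, map_add]
    abel
  -- Dividing `l` by `wt` undoes the conjugation: `u` represents zero, so the levels are constant.
  obtain ⟨x, hx⟩ := X.exists_forall_levelSum_eq θ (u := fun m => (wt m : 𝕜)⁻¹ • l.1 m)
      (v := fun m => (wt m : 𝕜)⁻¹ • l.2 m) fun m => by
    have h1 := X.levelSum_smul θ (fun m => (wt m : 𝕜)⁻¹) (u : SeqPair X₀ X₁ q).1
      (u : SeqPair X₀ X₁ q).2 m
    rw [X.levelSum_eq_zero_of_mem u.2, smul_zero] at h1
    rw [← h1, ← hl]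
    congr 1
    · funext m
      change _ = (wt m : 𝕜)⁻¹ • (l.1 m - (r m : 𝕜) • l.1 (m - 1))
      rw [smul_sub, smul_smul, smul_smul, hrwt]
    · funext m
      change _ = (wt m : 𝕜)⁻¹ • (l.2 m - (2 * (r m : 𝕜)) • l.2 (m - 1))
      rw [smul_sub, smul_smul, smul_smul, mul_left_comm, hrwt, mul_assoc]
  have hnorm : ∀ m, ‖(wt m : 𝕜)⁻¹‖ = (wt m)⁻¹ := fun m => by
    rw [norm_inv, RCLike.norm_ofReal, abs_of_pos (hwt0 m)]
  have hn1 : ∀ m, ‖(wt m : 𝕜)⁻¹‖ ≤ 1 := fun m => by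
    rw [hnorm]
    exact inv_le_one_of_one_le₀ (hwt1 m)
  have hn2 : ∀ m, ‖dyadicWeight 𝕜 (θ - θ') m * (wt m : 𝕜)⁻¹‖ ≤ 1 := fun m => by
    rw [norm_mul, norm_dyadicWeight, hnorm, ← div_eq_mul_inv, div_le_one (hwt0 m)]
    exact le_add_of_nonneg_left zero_le_one
  refine ⟨x, ?_, ?_, ?_⟩
  · refine X.mem_realSubmodule_of_levelSum_eq hθ hx ?_ ?_
    · simp only [sub_self, dyadicWeight_zero, one_smul]
      exact (lp.memℓp l.1).mono' fun m => by
        rw [norm_smul]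
        exact mul_le_of_le_one_left (norm_nonneg _) (hn1 m)
    · simp only [sub_self, dyadicWeight_zero, one_smul]
      exact (lp.memℓp l.2).mono' fun m => by
        rw [norm_smul]
        exact mul_le_of_le_one_left (norm_nonneg _) (hn1 m)
  · refine X.mem_realSubmodule_of_levelSum_eq hθ' hx ?_ ?_
    · simp only [smul_smul]
      exact (lp.memℓp l.1).mono' fun m => by
        rw [norm_smul]
        exact mul_le_of_le_one_left (norm_nonneg _) (hn2 m)
    · simp only [smul_smul]
      exact (lp.memℓp l.2).mono' fun m => by
        rw [norm_smul]
        exact mul_le_of_le_one_left (norm_nonneg _) (hn2 m)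
  -- After division by `wt`, `T l` differs from the pair of `y` by `w / wt`, which represents zero;
  -- level `0` suffices since the levels are constant.
  · have h1 := Y.levelSum_smul θ (fun m => (wt m : 𝕜)⁻¹) (w : SeqPair Y₀ Y₁ q).1
      (w : SeqPair Y₀ Y₁ q).2 0
    rw [Y.levelSum_eq_zero_of_mem w.2, smul_zero] at h1
    rw [← sub_eq_zero, ← hx 0, map_levelSum, ← hab 0, ← neg_sub, neg_eq_zero, ← levelSum_sub,
      ← h1]
    congr 1
    · funext m
      have h2 : T.restr₀ (l.1 m) + (w : SeqPair Y₀ Y₁ q).1 m = (wt m : 𝕜) • a m := by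
        rw [← hk1, ← hkl]
        rfl
      rw [Pi.sub_apply, map_smul, sub_eq_iff_eq_add, ← smul_add, add_comm, h2,
        inv_smul_smul₀ (hwtk m)]
    · funext m
      have h2 : T.restr₁ (l.2 m) + (w : SeqPair Y₀ Y₁ q).2 m = (wt m : 𝕜) • b m := by
        rw [← hk2, ← hkl]
        rfl
      rw [Pi.sub_apply, map_smul, sub_eq_iff_eq_add, ← smul_add, add_comm, h2,
        inv_smul_smul₀ (hwtk m)]

theorem toSum_inverse_eq (T : Operator X Y) {θ : ℝ} (hT : (T.interp θ q).IsInvertible) {x : X.sum}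
    (hx : x ∈ X.realSubmodule θ q) {y : Y.sum} (hy : y ∈ Y.realSubmodule θ q)
    (h : T.toLinearMap x = y) :
    RealInterp.toSum ((T.interp θ q).inverse (RealInterp.mk y hy)) = x := by
  have h1 : T.interp θ q (RealInterp.mk x hx) = RealInterp.mk y hy :=
    RealInterp.toSum_injective h
  rw [← h1, hT.inverse_apply_self]
  rfl

end BanachCouple.Operator

end

/-! ### From local to global agreement -/

theorem mainTheorem5 {𝕜 X₀ X₁ E Y₀ Y₁ F : Type*} [RCLike 𝕜]
    [NormedAddCommGroup X₀] [NormedSpace 𝕜 X₀] [CompleteSpace X₀]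
    [NormedAddCommGroup X₁] [NormedSpace 𝕜 X₁] [CompleteSpace X₁]
    [AddCommGroup E] [Module 𝕜 E] [TopologicalSpace E] [IsTopologicalAddGroup E]
    [ContinuousSMul 𝕜 E] [T2Space E]
    [NormedAddCommGroup Y₀] [NormedSpace 𝕜 Y₀] [CompleteSpace Y₀]
    [NormedAddCommGroup Y₁] [NormedSpace 𝕜 Y₁] [CompleteSpace Y₁]
    [AddCommGroup F] [Module 𝕜 F] [TopologicalSpace F] [IsTopologicalAddGroup F]
    [ContinuousSMul 𝕜 F] [T2Space F]
    (X : BanachCouple 𝕜 X₀ X₁ E) (Y : BanachCouple 𝕜 Y₀ Y₁ F) (T : BanachCouple.Operator X Y)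
    (q : ℝ≥0∞) [Fact (1 ≤ q)] (I : Set ℝ) (hI : T.IsIntervalOfInvertibility q I)
    (θ₀ θ₁ : ℝ) (hθ₀ : θ₀ ∈ I) (hθ₁ : θ₁ ∈ I)
    (y : Y.sum) (hy₀ : y ∈ Y.realSubmodule θ₀ q) (hy₁ : y ∈ Y.realSubmodule θ₁ q) :
    BanachCouple.RealInterp.toSum ((T.interp θ₀ q).inverse (BanachCouple.RealInterp.mk y hy₀)) =
      BanachCouple.RealInterp.toSum
        ((T.interp θ₁ q).inverse (BanachCouple.RealInterp.mk y hy₁)) := by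
  have hIcc : uIcc θ₀ θ₁ ⊆ I := hI.ordConnected.uIcc_subset hθ₀ hθ₁
  have hmem : ∀ θ ∈ uIcc θ₀ θ₁, y ∈ Y.realSubmodule θ q := fun θ hθ =>
    Y.mem_realSubmodule_of_mem_uIcc (hI.subset hθ₀) (hI.subset hθ₁) hθ hy₀ hy₁
  -- A symmetric, transitive relation that holds between each point and its neighbours holds
  -- throughout a preconnected set.
  have key := isPreconnected_uIcc.induction₂ (s := uIcc θ₀ θ₁)
    (fun θ θ' => ∀ (h : y ∈ Y.realSubmodule θ q) (h' : y ∈ Y.realSubmodule θ' q),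
      BanachCouple.RealInterp.toSum ((T.interp θ q).inverse (BanachCouple.RealInterp.mk y h)) =
        BanachCouple.RealInterp.toSum
          ((T.interp θ' q).inverse (BanachCouple.RealInterp.mk y h')))
    ?_ ?_ ?_ left_mem_uIcc right_mem_uIcc
  · exact key hy₀ hy₁
  · intro θ hθ
    have hinv := hI.isInvertible θ (hIcc hθ)
    filter_upwards [nhdsWithin_le_nhds
      (T.exists_mem_inter_of_surjective (hI.subset (hIcc hθ)) hinv.surjective),
      self_mem_nhdsWithin] with θ' hθ' hθ'I h h'
    obtain ⟨x, hx, hx', hTx⟩ := hθ' (hI.subset (hIcc hθ'I)) y h h'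
    rw [T.toSum_inverse_eq hinv hx h hTx,
      T.toSum_inverse_eq (hI.isInvertible θ' (hIcc hθ'I)) hx' h' hTx]
  -- Transitivity needs `y` in the space for the middle parameter, where the relation would
  -- otherwise be vacuous.
  · intro θ θ' θ'' _ hθ' _ h1 h2 h h''
    exact (h1 h (hmem θ' hθ')).trans (h2 (hmem θ' hθ') h'')
  · intro θ θ' _ _ h1 h h'
    exact (h1 h' h).symm
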